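/- Let $n\ge 1$. For a Radon measure $\mu$ on $\mathbb R^{n+1}$, $x_0\in\mathbb R^{n+1}$, $t_0>0$ and $I\subset(0,\infty)$ put \[F_{x_0,t_0}(\mu)=\frac{1}{(4\pi t_0)^{n/2}}\int e^{-\frac{|x-x_0|^2}{4t_0}}\,d\mu(x),\qquad \lambda^I(\mu)=\sup_{x_0\in\mathbb R^{n+1},\,t_0\in I}F_{x_0,t_0}(\mu),\qquad \lambda(\mu)=\lambda^{(0,\infty)}(\mu).\] For a closed (compact, without boundary) smooth embedded hypersurface $\Sigma\subset\mathbb R^{n+1}$ and an integer $m\ge 1$ write $m\Sigma$ for the measure $m\,\mathcal H^n\llcorner\Sigma$, and $\Sigma$ for $1\Sigma$. Such a $\Sigma$ is a self-shrinker if $H=\langle x,\mathbf n\rangle/2$, where $\mathbf n$ is a unit normal and $H=\operatorname{div}_\Sigma\mathbf n$. A mean curvature flow is a smooth family $\{M_t\}$ of closed embedded hypersurfaces with $\partial_t x=-H\mathbf n$. Let $\Sigma$ be a closed embedded self-shrinker, let $m\ge1$ be an integer, and let $\alpha>0$, $T\in\mathbb R$, $0<a<1$. Let $M\subset\mathbb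 R^{n+1}$ be a closed smooth embedded hypersurface and let $\{M_t\}_{t\in[T-\alpha^{-2},T')}$ be a mean curvature flow with $M_{T-\alpha^{-2}}=M$. We say that $m\Sigma$ is a blow-up limit of $M_t$ at time $s\in(T-\alpha^{-2},T']$ if there are $y\in\mathbb R^{n+1}$ and $\alpha_i\to\infty$ such that, for every $t<0$, the hypersurfaces $\alpha_i(M_{s+\alpha_i^{-2}t}-y)$ (defined for large $i$) converge to $m\sqrt{-t}\,\Sigma$ as Radon measures. (1) If $b>1$ and $\lambda^{[a\alpha^{-2},\,b\alpha^{-2}]}(M)<\lambda(m\Sigma)$, then $m\Sigma$ is not a blow-up limit of $M_t$ at any time $s\in[T+(a-1)\alpha^{-2},\,T+(b-1)\alpha^{-2}]$. (2) If $\lambda^{[a\alpha^{-2},\,\infty)}(M)<\lambda(m\Sigma)$, then $m\Sigma$ is not a blow-up limit of $M_t$ at any time $s\in[T+(a-1)\alpha^{-2},\,\infty)$. -/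

import Mathlib

open scoped Manifold ContDiff ENNReal Topology MeasureTheory Pointwise

noncomputable section

namespace MCF

/-- The ambient space `ℝ^{n+1}` of hypersurfaces of dimension `n`. -/
abbrev Ambient (n : ℕ) : Type := EuclideanSpace ℝ (Fin (n + 1))

/-! ### Gaussian functionals of measures on `ℝ^{n+1}` -/

/-- The Gaussian functional `F_{x₀,t₀}(μ) = (4πt₀)^{-n/2} ∫ exp(-|x-x₀|²/(4t₀)) dμ(x)`, `t₀ > 0`. -/
def gaussianF (n : ℕ) (x₀ : Ambient n) (t₀ : ℝ) (μ : MeasureTheory.Measure (Ambient n)) : ℝ≥0∞ :=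
  ENNReal.ofReal ((4 * Real.pi * t₀) ^ (-(n : ℝ) / 2)) *
    ∫⁻ x, ENNReal.ofReal (Real.exp (-‖x - x₀‖ ^ 2 / (4 * t₀))) ∂μ

/-- The local entropy `λ^I(μ)`, the supremum of `F_{x₀,t₀}(μ)` over `x₀ ∈ ℝ^{n+1}`, `t₀ ∈ I`, for a
set of scales `I ⊆ (0, ∞)`. -/
def localEntropy (n : ℕ) (I : Set ℝ) (μ : MeasureTheory.Measure (Ambient n)) : ℝ≥0∞ :=
  ⨆ x₀ : Ambient n, ⨆ t₀ ∈ I, gaussianF n x₀ t₀ μ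

/-- The entropy `λ(μ)`, the supremum of `F_{x₀,t₀}(μ)` over `x₀ ∈ ℝ^{n+1}` and all `t₀ > 0`. -/
def entropy (n : ℕ) (μ : MeasureTheory.Measure (Ambient n)) : ℝ≥0∞ :=
  localEntropy n (Set.Ioi 0) μ

/-- The measure `mS`: `n`-dimensional Hausdorff measure (normalized to agree with Lebesgue measure
on `n`-planes) restricted to `S`, with multiplicity `m`. -/
def areaMeasure (n m : ℕ) (S : Set (Ambient n)) : MeasureTheory.Measure (Ambient n) :=
  (m : ℝ≥0∞) • (μHE[n] : MeasureTheory.Measure (Ambient n)).restrict S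

/-- Convergence `μ_i → μ` as Radon measures. -/
def ConvergesAsRadon (n : ℕ) (μs : ℕ → MeasureTheory.Measure (Ambient n))
    (μ : MeasureTheory.Measure (Ambient n)) : Prop :=
  ∀ φ : Ambient n → ℝ, Continuous φ → HasCompactSupport φ →
    Filter.Tendsto (fun i => ∫ x, φ x ∂(μs i)) Filter.atTop (𝓝 (∫ x, φ x ∂μ))

/-! ### Embedded hypersurfaces and their mean curvature -/

section Hypersurface

variable {n : ℕ} {N : Type*} [TopologicalSpace N] [ChartedSpace (EuclideanSpace ℝ (Fin n)) N]

/-- `f : N → ℝ^{n+1}` is a smooth embedding of the `n`-manifold `N`. -/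
structure IsEmbeddedHypersurface (f : N → Ambient n) : Prop where
  smooth : ContMDiff (𝓡 n) 𝓘(ℝ, Ambient n) ∞ f
  immersion : ∀ p, Function.Injective (mfderiv (𝓡 n) 𝓘(ℝ, Ambient n) f p)
  embedding : Topology.IsEmbedding f

/-- `ν` is a unit normal vector at `p` of the hypersurface parametrized by `f`. -/
def IsUnitNormal (f : N → Ambient n) (p : N) (ν : Ambient n) : Prop :=
  ‖ν‖ = 1 ∧ ∀ v, inner ℝ ν (mfderiv (𝓡 n) 𝓘(ℝ, Ambient n) f p v) = 0

/-- `f` in the preferred local coordinates around `p`. -/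
def localParam (f : N → Ambient n) (p : N) : EuclideanSpace ℝ (Fin n) → Ambient n :=
  f ∘ (extChartAt (𝓡 n) p).symm

/-- The coordinate vector `∂_i f` at `p`. -/
def coordVector (f : N → Ambient n) (p : N) (i : Fin n) : Ambient n :=
  fderiv ℝ (localParam f p) (extChartAt (𝓡 n) p p) (EuclideanSpace.single i 1)

/-- The second coordinate derivative `∂_i ∂_j f` at `p`. -/
def coordSecondDeriv (f : N → Ambient n) (p : N) (i j : Fin n) : Ambient n :=
  fderiv ℝ (fderiv ℝ (localParam f p)) (extChartAt (𝓡 n) p p)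
    (EuclideanSpace.single i 1) (EuclideanSpace.single j 1)

/-- The induced metric `g_{ij} = ⟨∂_i f, ∂_j f⟩` at `p`. -/
def inducedMetric (f : N → Ambient n) (p : N) : Matrix (Fin n) (Fin n) ℝ :=
  Matrix.of fun i j => inner ℝ (coordVector f p i) (coordVector f p j)

/-- The mean curvature at `p` with respect to the unit normal `ν`,
`H = -∑ g^{ij} ⟨∂_i ∂_j f, ν⟩` (the tangential divergence of `ν`), so that a sphere of radius `r`
has `H = n / r` for the outward normal. It changes sign with `ν`, so `H ν` is well defined. -/
def meanCurvature (f : N → Ambient n) (p : N) (ν : Ambient n) : ℝ :=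
  -∑ i, ∑ j, (inducedMetric f p)⁻¹ i j * inner ℝ (coordSecondDeriv f p i j) ν

/-- An embedded hypersurface is a self-shrinker if `H = ⟨x, 𝐧⟩ / 2`. -/
structure IsSelfShrinker (f : N → Ambient n) : Prop where
  hypersurface : IsEmbeddedHypersurface f
  equation : ∀ p ν, IsUnitNormal f p ν → meanCurvature f p ν = inner ℝ (f p) ν / 2

/-- A smooth family `F t`, `t ∈ [t₀, t₁)`, of embedded hypersurfaces flowing by mean curvature,
`∂_t x = -H 𝐧`. -/
structure IsMeanCurvatureFlow (t₀ t₁ : ℝ) (F : ℝ → N → Ambient n) : Prop where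
  lt : t₀ < t₁
  smooth : ContMDiffOn (𝓘(ℝ, ℝ).prod (𝓡 n)) 𝓘(ℝ, Ambient n) ∞
    (fun q : ℝ × N => F q.1 q.2) (Set.Ico t₀ t₁ ×ˢ Set.univ)
  hypersurface : ∀ t ∈ Set.Ico t₀ t₁, IsEmbeddedHypersurface (F t)
  equation : ∀ t ∈ Set.Ico t₀ t₁, ∀ p ν, IsUnitNormal (F t) p ν →
    HasDerivWithinAt (fun s => F s p) (-(meanCurvature (F t) p ν) • ν) (Set.Ico t₀ t₁) t

end Hypersurface

/-! ### Blow-up limits -/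

/-- The parabolic rescaling `M_t^{α,(y,s)} = α (M_{s + α⁻² t} - y)`. -/
def parabolicRescaling {n : ℕ} (M : ℝ → Set (Ambient n)) (α : ℝ) (y : Ambient n) (s t : ℝ) :
    Set (Ambient n) :=
  (fun x => α • (x - y)) '' M (s + α ^ (-2 : ℤ) * t)

/-- `mS` is a blow-up limit at `(y, s)` of the family of sets `M t`, `t ∈ [t₀, t₁)`: along some
scales `α_i → ∞`, the rescaled sets `M_t^{α_i,(y,s)}` converge as Radon measures to `m √(-t) S`,
for every `t < 0`. As `t₀ < s ≤ t₁`, for every `t < 0` the time `s + α_i⁻² t` lies in `[t₀, t₁)`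
for large `i`. -/
def IsBlowUpLimit {n : ℕ} (t₀ t₁ : ℝ) (M : ℝ → Set (Ambient n)) (y : Ambient n) (s : ℝ)
    (m : ℕ) (S : Set (Ambient n)) : Prop :=
  t₀ < s ∧ s ≤ t₁ ∧ ∃ α : ℕ → ℝ, (∀ i, 0 < α i) ∧ Filter.Tendsto α Filter.atTop Filter.atTop ∧
    ∀ t < 0, ConvergesAsRadon n (fun i => areaMeasure n 1 (parabolicRescaling M (α i) y s t))
      (areaMeasure n m (√(-t) • S))

end MCF

end

/-! The engine is Huisken's monotonicity: along a mean curvature flow starting at time `t₀`, the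
Gaussian functional satisfies `F_{x₀,τ}(M_t) ≤ F_{x₀,τ+(t-t₀)}(M_{t₀})`. Suppose `mΣ` is a blow-up
limit at `(y, s)` along scales `α_i`, and look only at the rescaled time `-1`. By parabolic scaling,
`F_{x₀,τ}` of the rescaled hypersurface is the Gaussian functional of `M_{s-α_i⁻²}` with centre `y +
x₀/α_i` and scale `τ/α_i²`. Monotonicity bounds it by the functional of `M` with the same centre and
scale `τ/α_i² + s - α_i⁻² - t₀`. As `i → ∞` this bound tends to `F_{y,s-t₀}(M)`, whatever `(x₀, τ)`
was, while Radon convergence makes the left side at least `F_{x₀,τ}(mΣ)` in the limit. Hence `λ(mΣ)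
≤ F_{y,s-t₀}(M)` (`entropy_le_gaussianF_of_isBlowUpLimit`). With `t₀ = T - α⁻²`, the assumed range
of `s` says exactly that `s - t₀` is an admissible scale of the local entropy, which contradicts the
strict inequality.

Monotonicity itself is proved in charts. Let `Φ` be the backward heat kernel along the flow, `w =
√det g`, and `r = x - x₀`. The pointwise statement `fderiv_heatDensity_mul_volDensity_add_le` is
`∂_t(Φ w) + ∂_i(w g^{ij} ∂_jΦ) ≤ 0`, where the left side is `-Φ w` times the squared length of the
velocity plus `r^⊥/(2τ)`, with `τ` here the time remaining. It rests on two facts: the velocity is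
the mean curvature vector in every chart, and `∂_i(w g^{ij} ∂_j x)` is `w` times that vector.

To globalize, the inequality is multiplied by a partition of unity `χ_k` subordinate to charts and
integrated by parts. The remaining terms are integrals of `⟨∇χ_k, ∇Φ⟩`, which is independent of
coordinates; written against the Hausdorff area measure they add up to zero because `∑ χ_k = 1`. The
area formula, proved first, identifies the chart density `√det g` with this Hausdorff measure. -/

namespace MCF

/-! ### The area formula for injective immersions. -/

section AreaFormula

open MeasureTheory Set Filter Module

/-- A measure dominated by another one near every point is dominated by it. -/
theorem measure_le_of_forall_exists_nhds {X : Type*} [TopologicalSpace X]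
    [SecondCountableTopology X] [MeasurableSpace X] [OpensMeasurableSpace X] {μ ν : Measure X}
    (h : ∀ x, ∃ W ∈ 𝓝 x, ∀ A ⊆ W, MeasurableSet A → μ A ≤ ν A) : μ ≤ ν := by
  choose W hW hle using h
  obtain ⟨t, htc, hcov⟩ := TopologicalSpace.countable_cover_nhds
    (fun x => interior_mem_nhds.2 (hW x))
  rcases isEmpty_or_nonempty X with hX | ⟨⟨x₀⟩⟩
  · exact Measure.le_iff.2 fun s _ => by simp [Set.eq_empty_of_isEmpty s]
  have htne : t.Nonempty := by
    rw [Set.nonempty_iff_ne_empty]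
    rintro rfl
    simpa using (hcov ▸ Set.mem_univ x₀ : x₀ ∈ ⋃ x ∈ (∅ : Set X), interior (W x))
  obtain ⟨e, rfl⟩ := htc.exists_eq_range htne
  set s : ℕ → Set X := fun i => interior (W (e i))
  have hs : ⋃ i, s i = univ := by simpa [s] using hcov
  refine Measure.le_iff.2 fun A hA => ?_
  -- Disjointing the countable subcover reduces the inequality, by countable additivity on both
  -- sides, to pieces lying in a single neighbourhood.
  have hm : ∀ i, MeasurableSet (A ∩ disjointed s i) := fun i =>
    hA.inter (MeasurableSet.disjointed (fun j => isOpen_interior.measurableSet) i)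
  have hd : Pairwise (Function.onFun Disjoint fun i => A ∩ disjointed s i) := fun i j hij =>
    ((disjoint_disjointed s) hij).mono inter_subset_right inter_subset_right
  have hAe : A = ⋃ i, A ∩ disjointed s i := by
    rw [← inter_iUnion, iUnion_disjointed, hs, inter_univ]
  rw [hAe, measure_iUnion hd hm, measure_iUnion hd hm]
  exact ENNReal.tsum_le_tsum fun i => hle (e i) _
    ((inter_subset_right.trans (disjointed_subset s i)).trans interior_subset) (hm i)

/-- If `f` is Lipschitz relative to `g` on `A`, the Hausdorff measures of the images compare. -/
theorem euclideanHausdorffMeasure_image_le_of_dist_le {X Y Z : Type*} [MetricSpace Y]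
    [MetricSpace Z] [MeasurableSpace Y] [MeasurableSpace Z] [BorelSpace Y] [BorelSpace Z]
    {f : X → Y} {g : X → Z} {A : Set X} {K : NNReal} (d : ℕ)
    (h : ∀ x ∈ A, ∀ y ∈ A, dist (f x) (f y) ≤ K * dist (g x) (g y)) :
    μHE[d] (f '' A) ≤ (K : ℝ≥0∞) ^ d * μHE[d] (g '' A) := by
  rcases A.eq_empty_or_nonempty with rfl | ⟨a, ha⟩
  · simp
  have : Nonempty X := ⟨a⟩
  -- The hypothesis forces `f x = f y` whenever `g x = g y` on `A`, so `f` factors through `g`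
  -- there. The factor is `K`-Lipschitz on `g '' A`.
  set φ : Z → Y := f ∘ Function.invFunOn g A
  have hφ : LipschitzOnWith K φ (g '' A) := by
    refine LipschitzOnWith.of_dist_le_mul fun x hx y hy => ?_
    have := h _ (Function.invFunOn_mem hx) _ (Function.invFunOn_mem hy)
    rwa [Function.invFunOn_eq hx, Function.invFunOn_eq hy] at this
  have him : φ '' (g '' A) = f '' A := by
    rw [image_image]
    refine image_congr fun x hx => ?_
    have hx' : g x ∈ g '' A := mem_image_of_mem g hx
    have := h _ (Function.invFunOn_mem hx') _ hx
    rw [Function.invFunOn_eq hx', dist_self, mul_zero] at this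
    exact dist_le_zero.1 this
  have := hφ.hausdorffMeasure_image_le (d := d) (by positivity)
  rw [him, ENNReal.rpow_natCast] at this
  simp only [Measure.euclideanHausdorffMeasure_def, Measure.smul_apply, ENNReal.smul_def,
    smul_eq_mul]
  rw [mul_left_comm]
  gcongr

variable {E V : Type*} [NormedAddCommGroup E] [InnerProductSpace ℝ E] [FiniteDimensional ℝ E]
  [NormedAddCommGroup V] [InnerProductSpace ℝ V]

theorem normDet_eq_sqrt_det_gram {ι : Type*} [Fintype ι] [DecidableEq ι] (f : E →L[ℝ] V)
    (b : OrthonormalBasis ι ℝ E) :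
    (f : E →ₗ[ℝ] V).normDet = √(Matrix.gram ℝ (fun i => f (b i))).det := by
  have := (f : E →ₗ[ℝ] V).normDet_sq_eq_det_gram b
  simp only [RCLike.ofReal_real_eq_id, id_eq, ContinuousLinearMap.coe_coe] at this
  rw [← this, Real.sqrt_sq (LinearMap.normDet_nonneg _)]

theorem continuous_normDet :
    Continuous fun f : E →L[ℝ] V => (f : E →ₗ[ℝ] V).normDet := by
  simp_rw [fun f : E →L[ℝ] V => normDet_eq_sqrt_det_gram f (stdOrthonormalBasis ℝ E)]
  refine Real.continuous_sqrt.comp (Continuous.matrix_det ?_)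
  refine continuous_matrix fun i j => ?_
  simp only [Matrix.gram_apply]
  fun_prop

theorem normDet_pos {f : E →L[ℝ] V} (hf : Function.Injective f) :
    0 < (f : E →ₗ[ℝ] V).normDet := by
  refine lt_of_le_of_ne (LinearMap.normDet_nonneg _) (Ne.symm ?_)
  rw [Ne, LinearMap.normDet_eq_zero_iff_ker_ne_bot, not_not]
  exact LinearMap.ker_eq_bot.2 hf

variable [MeasurableSpace V] [BorelSpace V]

/-- Near a point with injective strict derivative `L`, the linearization error is a small fraction
of `‖L (a - b)‖`, because `L` is bounded below. Hence `f` and `L` are `K`-Lipschitz relative to each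
other, with `K` as close to 1 as desired. -/
theorem exists_nhds_euclideanHausdorffMeasure_image {f : E → V} {L : E →L[ℝ] V} {x : E}
    (hf : HasStrictFDerivAt f L x) (hL : Function.Injective L) {K : NNReal} (hK : 1 < K) (d : ℕ) :
    ∃ W ∈ 𝓝 x, ∀ A ⊆ W, μHE[d] (f '' A) ≤ (K : ℝ≥0∞) ^ d * μHE[d] (L '' A) ∧
      μHE[d] (L '' A) ≤ (K : ℝ≥0∞) ^ d * μHE[d] (f '' A) := by
  obtain ⟨C, hC, hCL⟩ := LinearMap.exists_antilipschitzWith (L : E →ₗ[ℝ] V)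
    (LinearMap.ker_eq_bot.2 hL)
  have hK0 : (0 : ℝ) < K := by positivity
  have hK1 : (1 : ℝ) < K := hK
  -- Chosen so that `1 + η ≤ K` and `K (1 - η) = 1`, one relation for each direction of the
  -- comparison.
  set η : ℝ := (K - 1) / K with hη
  have hη0 : 0 < η := div_pos (by linarith) hK0
  have hC0 : (0 : ℝ) < C := hC
  obtain ⟨W, hW, happ⟩ := hf.approximates_deriv_on_nhds (c := (η / C).toNNReal)
    (Or.inr (Real.toNNReal_pos.2 (by positivity)))
  have key : ∀ a ∈ W, ∀ b ∈ W, ‖f a - f b - L (a - b)‖ ≤ η * ‖L (a - b)‖ := by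
    intro a ha b hb
    have h1 := happ a ha b hb
    have h2 := hCL.le_mul_dist a b
    rw [dist_eq_norm, dist_eq_norm] at h2
    have h3 : (L : E →ₗ[ℝ] V) a - (L : E →ₗ[ℝ] V) b = L (a - b) := by simp
    rw [h3] at h2
    rw [Real.coe_toNNReal _ (by positivity)] at h1
    calc _ ≤ η / C * ‖a - b‖ := h1
      _ ≤ η / C * (C * ‖L (a - b)‖) := by gcongr
      _ = _ := by field_simp
  refine ⟨W, hW, fun A hA => ⟨?_, ?_⟩⟩
  · refine euclideanHausdorffMeasure_image_le_of_dist_le d fun a ha b hb => ?_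
    have := key a (hA ha) b (hA hb)
    rw [dist_eq_norm, dist_eq_norm, ← map_sub]
    have h1 : ‖f a - f b‖ ≤ ‖f a - f b - L (a - b)‖ + ‖L (a - b)‖ := by
      simpa using norm_add_le (f a - f b - L (a - b)) (L (a - b))
    have h2 : 1 + η ≤ K := by
      rw [hη, ← sub_nonneg]
      have : (K : ℝ) - (1 + (K - 1) / K) = (K - 1) ^ 2 / K := by field_simp; ring
      rw [this]; positivity
    nlinarith [norm_nonneg (L (a - b))]
  · refine euclideanHausdorffMeasure_image_le_of_dist_le d fun a ha b hb => ?_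
    have := key a (hA ha) b (hA hb)
    rw [dist_eq_norm, dist_eq_norm, ← map_sub]
    have h1 : ‖L (a - b)‖ ≤ ‖f a - f b - L (a - b)‖ + ‖f a - f b‖ := by
      rw [norm_sub_rev (f a - f b)]
      simpa using norm_add_le (L (a - b) - (f a - f b)) (f a - f b)
    have h2 : (K : ℝ) * (1 - η) = 1 := by rw [hη]; field_simp; ring
    have h3 : (1 - η) * ‖L (a - b)‖ ≤ ‖f a - f b‖ := by linarith
    calc ‖L (a - b)‖ = K * ((1 - η) * ‖L (a - b)‖) := by rw [← mul_assoc, h2, one_mul]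
      _ ≤ _ := by gcongr

variable [MeasurableSpace E] [BorelSpace E]

/-- **Area formula** for an injective immersion. -/
theorem euclideanHausdorffMeasure_image_eq_lintegral {f : E → V} {f' : E → E →L[ℝ] V} {U : Set E}
    (hU : IsOpen U) (hf : ∀ x ∈ U, HasStrictFDerivAt f (f' x) x) (hc : ContinuousOn f' U)
    (hi : ∀ x ∈ U, Function.Injective (f' x)) (hinj : InjOn f U) {A : Set E}
    (hA : MeasurableSet A) (hAU : A ⊆ U) :
    μHE[finrank ℝ E] (f '' A) =
      ∫⁻ x in A, ENNReal.ofReal ((f' x : E →ₗ[ℝ] V).normDet) := by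
  set d := finrank ℝ E
  set J : E → ℝ := fun x => (f' x : E →ₗ[ℝ] V).normDet with hJ
  have hcf : ContinuousOn f U := fun x hx => (hf x hx).continuousAt.continuousWithinAt
  have hJc : ContinuousOn J U := continuous_normDet.comp_continuousOn hc
  -- An injective continuous map on the Polish space `U` is a measurable embedding, so the Hausdorff
  -- measure of images defines a measure on `U`.
  have hemb : MeasurableEmbedding (U.domRestrict f) :=
    haveI : PolishSpace U := hU.polishSpace
    (continuousOn_iff_continuous_domRestrict.1 hcf).measurableEmbedding hinj.injective
  have hval : MeasurableEmbedding (Subtype.val : U → E) :=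
    MeasurableEmbedding.subtype_coe hU.measurableSet
  set μ : Measure U := Measure.comap (U.domRestrict f) μHE[d]
  set ν : Measure U := Measure.comap Subtype.val
    ((volume : Measure E).withDensity fun x => ENNReal.ofReal (J x))
  have hμ : ∀ B : Set U, μ B = μHE[d] (f '' (Subtype.val '' B)) := fun B => by
    rw [hemb.comap_apply, image_image]; rfl
  have hν : ∀ B : Set U, MeasurableSet B →
      ν B = ∫⁻ x in Subtype.val '' B, ENNReal.ofReal (J x) := fun B hB => by
    rw [hval.comap_apply, withDensity_apply _ (hval.measurableSet_image.2 hB)]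
  -- The power `K ^ d` comes from comparing `f` with its derivative at the point; the extra `K`
  -- bounds the oscillation of the Jacobian near it. The local bound becomes global because
  -- domination of measures can be checked near each point.
  have hloc : ∀ K : NNReal, 1 < K → μ ≤ (K : ℝ≥0∞) ^ (d + 1) • ν ∧
      ν ≤ (K : ℝ≥0∞) ^ (d + 1) • μ := by
    intro K hK
    have hnear : ∀ x : U, ∃ W ∈ 𝓝 x, ∀ B ⊆ W, MeasurableSet B →
        μ B ≤ ((K : ℝ≥0∞) ^ (d + 1) • ν) B ∧ ν B ≤ ((K : ℝ≥0∞) ^ (d + 1) • μ) B := by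
      intro x
      obtain ⟨W, hW, hWA⟩ := exists_nhds_euclideanHausdorffMeasure_image (hf x x.2) (hi x x.2) hK d
      have hJx : 0 < J x := normDet_pos (hi x x.2)
      have hJat : ContinuousAt J x := hJc.continuousAt (hU.mem_nhds x.2)
      have hK0 : (0 : ℝ) < K := zero_lt_one.trans hK
      have hK1 : (1 : ℝ) < K := hK
      have h1 : ∀ᶠ y in 𝓝 (x : E), J y < K * J x :=
        hJat.eventually (gt_mem_nhds (by nlinarith))
      have h2 : ∀ᶠ y in 𝓝 (x : E), J x < K * J y :=
        (hJat.const_mul (K : ℝ)).eventually (lt_mem_nhds (by nlinarith))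
      refine ⟨Subtype.val ⁻¹' (W ∩ {y | J y < K * J x} ∩ {y | J x < K * J y}),
        continuous_subtype_val.continuousAt.preimage_mem_nhds
          (inter_mem (inter_mem hW h1) h2), fun B hB hBm => ?_⟩
      have hB' : Subtype.val '' B ⊆ W ∩ {y | J y < K * J x} ∩ {y | J x < K * J y} :=
        image_subset_iff.2 hB
      have hBm' : MeasurableSet (Subtype.val '' B) := hval.measurableSet_image.2 hBm
      obtain ⟨hle, hge⟩ := hWA _ (fun y hy => (hB' hy).1.1)
      have hlin : μHE[d] (f' x '' (Subtype.val '' B)) =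
          ENNReal.ofReal (J x) * volume (Subtype.val '' B) :=
        LinearMap.euclideanHausdorffMeasure_image_eq_normDet_mul_volume _ _
      rw [hlin] at hle hge
      have hu : ∫⁻ y in Subtype.val '' B, ENNReal.ofReal (J y) ≤
          K * (ENNReal.ofReal (J x) * volume (Subtype.val '' B)) := by
        rw [← mul_assoc, ← setLIntegral_const]
        refine setLIntegral_mono' hBm' fun y hy => ?_
        rw [← ENNReal.ofReal_coe_nnreal, ← ENNReal.ofReal_mul hK0.le]
        exact ENNReal.ofReal_le_ofReal (hB' hy).1.2.le
      have hl : ENNReal.ofReal (J x) * volume (Subtype.val '' B) ≤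
          K * ∫⁻ y in Subtype.val '' B, ENNReal.ofReal (J y) := by
        rw [← setLIntegral_const, ← lintegral_const_mul' _ _ ENNReal.coe_ne_top]
        refine setLIntegral_mono' hBm' fun y hy => ?_
        rw [← ENNReal.ofReal_coe_nnreal, ← ENNReal.ofReal_mul hK0.le]
        exact ENNReal.ofReal_le_ofReal (hB' hy).2.le
      rw [Measure.smul_apply, Measure.smul_apply, hμ, hν B hBm, smul_eq_mul, smul_eq_mul, pow_succ]
      refine ⟨hle.trans ?_, hu.trans ?_⟩
      · rw [mul_assoc]; gcongr
      · rw [mul_comm (_ ^ d), mul_assoc]; gcongr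
    exact ⟨measure_le_of_forall_exists_nhds fun x =>
        (hnear x).imp fun W h => ⟨h.1, fun B hB hBm => (h.2 B hB hBm).1⟩,
      measure_le_of_forall_exists_nhds fun x =>
        (hnear x).imp fun W h => ⟨h.1, fun B hB hBm => (h.2 B hB hBm).2⟩⟩
  have hlim : ∀ c : ℝ≥0∞, Tendsto (fun K : NNReal => (K : ℝ≥0∞) ^ (d + 1) * c) (𝓝[>] 1) (𝓝 c) := by
    intro c
    have h1 : Tendsto (fun K : NNReal => (K : ℝ≥0∞) ^ (d + 1)) (𝓝[>] 1) (𝓝 1) := by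
      have : Continuous fun K : NNReal => ((K ^ (d + 1) : NNReal) : ℝ≥0∞) := by fun_prop
      simpa using (this.tendsto 1).mono_left nhdsWithin_le_nhds
    simpa using ENNReal.Tendsto.mul_const h1 (Or.inl one_ne_zero)
  have hAim : Subtype.val '' (Subtype.val ⁻¹' A : Set U) = A := by
    rw [Subtype.image_preimage_coe, inter_eq_right.2 hAU]
  have hpm : MeasurableSet (Subtype.val ⁻¹' A : Set U) := measurable_subtype_coe hA
  have e1 := hμ (Subtype.val ⁻¹' A)
  have e2 := hν _ hpm
  rw [hAim] at e1 e2
  rw [← e1, ← e2]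
  -- Both inequalities become exact as `K` decreases to 1.
  refine le_antisymm (ge_of_tendsto (hlim _) ?_) (ge_of_tendsto (hlim _) ?_)
  · filter_upwards [self_mem_nhdsWithin] with K hK using (hloc K hK).1 _
  · filter_upwards [self_mem_nhdsWithin] with K hK using (hloc K hK).2 _

end AreaFormula

end MCF

noncomputable section

namespace MCF

/-! ### Derivatives of determinants and inverse matrices. -/

section Jacobi

variable {ι : Type*} [Fintype ι] [DecidableEq ι]

/-- **Jacobi's formula** for the derivative of a determinant. -/
theorem hasDerivAt_det {A : ℝ → Matrix ι ι ℝ} {A' : Matrix ι ι ℝ} {x : ℝ}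
    (h : ∀ i j, HasDerivAt (fun t => A t i j) (A' i j) x) :
    HasDerivAt (fun t => (A t).det) ((A x).adjugate * A').trace x := by
  have h1 : HasDerivAt (fun t => ∑ σ : Equiv.Perm ι, (Equiv.Perm.sign σ : ℝ) * ∏ i, A t (σ i) i)
      (∑ σ : Equiv.Perm ι, (Equiv.Perm.sign σ : ℝ) *
        ∑ k, (∏ i ∈ Finset.univ.erase k, A x (σ i) i) • A' (σ k) k) x := by
    refine HasDerivAt.fun_sum fun σ _ => HasDerivAt.const_mul _ ?_
    exact HasDerivAt.fun_finsetProd fun i _ => h (σ i) i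
  simp_rw [Matrix.det_apply']
  convert h1 using 1
  -- Cramer's rule: this diagonal entry replaces one column of the determinant by its derivative,
  -- which is the corresponding term of the product rule.
  have h2 : ∀ k, ((A x).adjugate * A') k k = ((A x).updateCol k fun i => A' i k).det := by
    intro k
    rw [← Matrix.cramer_apply, Matrix.cramer_eq_adjugate_mulVec]
    simp [Matrix.mul_apply, Matrix.mulVec, dotProduct]
  simp only [Matrix.trace, Matrix.diag_apply, h2, Matrix.det_apply']
  rw [Finset.sum_comm]
  refine Finset.sum_congr rfl fun σ _ => ?_
  rw [Finset.mul_sum]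
  refine Finset.sum_congr rfl fun k _ => ?_
  rw [← Finset.mul_prod_erase _ _ (Finset.mem_univ k), Matrix.updateCol_self, smul_eq_mul,
    mul_comm (A' _ _)]
  congr 2
  refine Finset.prod_congr rfl fun i hi => ?_
  rw [Matrix.updateCol_ne (Finset.ne_of_mem_erase hi)]

/-- Jacobi's formula with `adj A = det A • A⁻¹`. Applied to a Gram matrix it gives the first
variation of area. -/
theorem hasDerivAt_sqrt_det {A : ℝ → Matrix ι ι ℝ} {A' : Matrix ι ι ℝ} {x : ℝ}
    (h : ∀ i j, HasDerivAt (fun t => A t i j) (A' i j) x) (hpos : 0 < (A x).det) :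
    HasDerivAt (fun t => √(A t).det) (√(A x).det / 2 * ((A x)⁻¹ * A').trace) x := by
  convert (hasDerivAt_det h).sqrt hpos.ne' using 1
  have hs : √(A x).det ≠ 0 := (Real.sqrt_pos.2 hpos).ne'
  have hs2 : √(A x).det * √(A x).det = (A x).det := Real.mul_self_sqrt hpos.le
  have : (A x).adjugate = (A x).det • (A x)⁻¹ := by
    rw [Matrix.inv_def, smul_smul, Ring.inverse_eq_inv', mul_inv_cancel₀ hpos.ne', one_smul]
  rw [this, Matrix.smul_mul, Matrix.trace_smul, smul_eq_mul]
  nth_rewrite 2 [← hs2]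
  field_simp

variable {Z : Type*} [NormedAddCommGroup Z] [NormedSpace ℝ Z]

theorem contDiffWithinAt_det {A : Z → Matrix ι ι ℝ} {s : Set Z} {z : Z} {k : WithTop ℕ∞}
    (h : ∀ i j, ContDiffWithinAt ℝ k (fun y => A y i j) s z) :
    ContDiffWithinAt ℝ k (fun y => (A y).det) s z := by
  simp_rw [Matrix.det_apply']
  exact ContDiffWithinAt.sum fun σ _ => contDiffWithinAt_const.mul
    (contDiffWithinAt_prod fun i _ => h _ _)

theorem contDiffWithinAt_inv_apply {A : Z → Matrix ι ι ℝ} {s : Set Z} {z : Z} {k : WithTop ℕ∞}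
    (h : ∀ i j, ContDiffWithinAt ℝ k (fun y => A y i j) s z) (hdet : (A z).det ≠ 0) (i j : ι) :
    ContDiffWithinAt ℝ k (fun y => (A y)⁻¹ i j) s z := by
  simp_rw [Matrix.inv_def, Matrix.smul_apply, Ring.inverse_eq_inv', smul_eq_mul,
    Matrix.adjugate_apply]
  refine ((contDiffWithinAt_det h).inv hdet).mul (contDiffWithinAt_det fun a b => ?_)
  by_cases hj : a = j
  · subst hj; simp only [Matrix.updateRow_self]; exact contDiffWithinAt_const
  · simp only [Matrix.updateRow_ne hj]; exact h a b

end Jacobi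

/-! ### First variation and the pointwise monotonicity inequality, for a map `H` on a space `Z`
(later space-time) with spatial directions `e i`. -/

section Calculus

variable {Z V : Type*} [NormedAddCommGroup Z] [NormedSpace ℝ Z]
  [NormedAddCommGroup V] [InnerProductSpace ℝ V]
  {ι : Type*}

/-- Derivatives below are computed along lines, where the one-variable product, quotient and chain
rules apply; uniqueness then identifies the value of `fderiv`. -/
theorem hasDerivAt_line {W : Type*} [NormedAddCommGroup W] [NormedSpace ℝ W] {f : Z → W} {z : Z}
    (hf : DifferentiableAt ℝ f z) (v : Z) :
    HasDerivAt (fun s : ℝ => f (z + s • v)) (fderiv ℝ f z v) 0 :=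
  hf.hasFDerivAt.hasLineDerivAt v

theorem fderiv_apply_eq_of_hasDerivAt_line {W : Type*} [NormedAddCommGroup W] [NormedSpace ℝ W]
    {f : Z → W} {z : Z} (hf : DifferentiableAt ℝ f z) {v : Z} {f' : W}
    (h : HasDerivAt (fun s : ℝ => f (z + s • v)) f' 0) : fderiv ℝ f z v = f' :=
  (hasDerivAt_line hf v).unique h

/-- The Gram matrix of the derivatives of `H` along the vectors `e i`. -/
def gramAt (H : Z → V) (e : ι → Z) (z : Z) : Matrix ι ι ℝ :=
  Matrix.gram ℝ fun i => fderiv ℝ H z (e i)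

theorem gramAt_isSymm (H : Z → V) (e : ι → Z) (z : Z) : (gramAt H e z).IsSymm :=
  Matrix.IsSymm.ext fun i j => by simp [gramAt, real_inner_comm]

theorem contDiffAt_fderiv_apply {H : Z → V} {z : Z} (hH : ContDiffAt ℝ ∞ H z) (v : Z) :
    ContDiffAt ℝ ∞ (fun y => fderiv ℝ H y v) z :=
  (hH.fderiv_right (m := ∞) (by simp)).clm_apply contDiffAt_const

theorem contDiffAt_gramAt {H : Z → V} {e : ι → Z} {z : Z}
    (hH : ContDiffAt ℝ ∞ H z) (i j : ι) :
    ContDiffAt ℝ ∞ (fun y => gramAt H e y i j) z :=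
  (contDiffAt_fderiv_apply hH (e i)).inner ℝ (contDiffAt_fderiv_apply hH (e j))

variable [Fintype ι] [DecidableEq ι]

/-- **Bessel's inequality** for a family of vectors with invertible Gram matrix. -/
theorem sum_inv_gram_mul_inner_le (b : ι → V) (hdet : (Matrix.gram ℝ b).det ≠ 0) (w : V) :
    ∑ i, ∑ j, (Matrix.gram ℝ b)⁻¹ i j * (inner ℝ w (b i) * inner ℝ w (b j)) ≤ ‖w‖ ^ 2 := by
  set g := Matrix.gram ℝ b with hg
  set c : ι → ℝ := fun j => ∑ i, g⁻¹ i j * inner ℝ w (b i) with hc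
  -- The orthogonal projection of `w` onto the span of `b`. The sum to be bounded equals both `⟨w,
  -- p⟩` and `⟨p, p⟩`, so the claim is `0 ≤ ‖w - p‖ ^ 2`.
  set p : V := ∑ j, c j • b j with hp
  have hwp : inner ℝ w p = ∑ j, c j * inner ℝ w (b j) := by
    simp [hp, inner_sum, inner_smul_right]
  have hpk : ∀ k, inner ℝ p (b k) = inner ℝ w (b k) := by
    intro k
    simp only [hp, sum_inner, inner_smul_left, hc, RCLike.conj_to_real, Finset.sum_mul]
    rw [Finset.sum_comm]
    have : ∀ i, ∑ j, g⁻¹ i j * inner ℝ w (b i) * inner ℝ (b j) (b k) =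
        inner ℝ w (b i) * (g⁻¹ * g) i k := by
      intro i
      rw [Matrix.mul_apply, Finset.mul_sum]
      exact Finset.sum_congr rfl fun j _ => by rw [hg, Matrix.gram_apply]; ring
    simp_rw [this, Matrix.nonsing_inv_mul g (isUnit_iff_ne_zero.2 hdet)]
    simp [Matrix.one_apply]
  have hpp : inner ℝ p p = ∑ j, c j * inner ℝ w (b j) := by
    nth_rewrite 2 [hp]
    simp [inner_sum, inner_smul_right, hpk]
  have hQ : ∑ i, ∑ j, g⁻¹ i j * (inner ℝ w (b i) * inner ℝ w (b j)) =
      ∑ j, c j * inner ℝ w (b j) := by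
    rw [Finset.sum_comm]
    refine Finset.sum_congr rfl fun j _ => ?_
    rw [hc, Finset.sum_mul]
    exact Finset.sum_congr rfl fun i _ => by ring
  have h0 : 0 ≤ ‖w - p‖ ^ 2 := by positivity
  rw [norm_sub_sq_real, ← real_inner_self_eq_norm_sq p, hpp, hwp] at h0
  rw [hQ]
  linarith

/-- The volume density `√det g` of a parametrization. -/
def volDensity (H : Z → V) (e : ι → Z) (z : Z) : ℝ := √(gramAt H e z).det

/-- The vectors `√det g · g^{ij} ∂_j H`. -/
def conormal (H : Z → V) (e : ι → Z) (i : ι) (z : Z) : V :=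
  ∑ j, (volDensity H e z * (gramAt H e z)⁻¹ i j) • fderiv ℝ H z (e j)

theorem inv_gramAt_comm (H : Z → V) (e : ι → Z) (z : Z) (i j : ι) :
    (gramAt H e z)⁻¹ i j = (gramAt H e z)⁻¹ j i := by
  have := Matrix.transpose_nonsing_inv (gramAt H e z)
  rw [(gramAt_isSymm H e z).eq] at this
  nth_rewrite 1 [← this]
  rfl

variable {H : Z → V} {e : ι → Z} {z : Z}

theorem contDiffAt_volDensity (hH : ContDiffAt ℝ ∞ H z) (hdet : 0 < (gramAt H e z).det) :
    ContDiffAt ℝ ∞ (volDensity H e) z := by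
  have : ContDiffAt ℝ ∞ (fun y => (gramAt H e y).det) z :=
    contDiffWithinAt_det fun i j => contDiffAt_gramAt hH i j
  exact this.sqrt hdet.ne'

theorem contDiffAt_densCometric (hH : ContDiffAt ℝ ∞ H z) (hdet : 0 < (gramAt H e z).det)
    (i j : ι) : ContDiffAt ℝ ∞ (fun y => volDensity H e y * (gramAt H e y)⁻¹ i j) z :=
  (contDiffAt_volDensity hH hdet).mul
    (contDiffWithinAt_inv_apply (fun i j => contDiffAt_gramAt hH i j) hdet.ne' i j)

theorem contDiffAt_conormal (hH : ContDiffAt ℝ ∞ H z) (hdet : 0 < (gramAt H e z).det) (i : ι) :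
    ContDiffAt ℝ ∞ (conormal H e i) z :=
  ContDiffAt.sum fun j _ => (contDiffAt_densCometric hH hdet i j).smul
    (contDiffAt_fderiv_apply hH (e j))

theorem fderiv_fderiv_apply_comm (hH : ContDiffAt ℝ ∞ H z) (v w : Z) :
    fderiv ℝ (fun y => fderiv ℝ H y v) z w = fderiv ℝ (fun y => fderiv ℝ H y w) z v := by
  have hd : DifferentiableAt ℝ (fderiv ℝ H) z :=
    (hH.fderiv_right (m := ∞) (by simp)).differentiableAt (by simp)
  have : ∀ a b : Z, fderiv ℝ (fun y => fderiv ℝ H y a) z b = fderiv ℝ (fderiv ℝ H) z b a := by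
    intro a b
    rw [fderiv_clm_apply hd (differentiableAt_const a)]
    simp
  rw [this, this]
  exact (hH.isSymmSndFDerivAt (by
    simpa using WithTop.coe_le_coe.2 (le_top : (2 : ℕ∞) ≤ ⊤))).eq w v

/-- First variation of the Gram matrix. -/
theorem fderiv_volDensity (hH : ContDiffAt ℝ ∞ H z) (hdet : 0 < (gramAt H e z).det) (v : Z) :
    fderiv ℝ (volDensity H e) z v = ∑ i, ∑ j, volDensity H e z * (gramAt H e z)⁻¹ i j *
      inner ℝ (fderiv ℝ (fun y => fderiv ℝ H y (e i)) z v) (fderiv ℝ H z (e j)) := by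
  refine fderiv_apply_eq_of_hasDerivAt_line
    ((contDiffAt_volDensity hH hdet).differentiableAt (by simp)) ?_
  have hd : ∀ i, HasDerivAt (fun s : ℝ => fderiv ℝ H (z + s • v) (e i))
      (fderiv ℝ (fun y => fderiv ℝ H y (e i)) z v) 0 := fun i =>
    hasDerivAt_line ((contDiffAt_fderiv_apply hH (e i)).differentiableAt (by simp)) v
  have hg : ∀ i j, HasDerivAt (fun s : ℝ => gramAt H e (z + s • v) i j)
      ((Matrix.of fun i j =>
        inner ℝ (fderiv ℝ H z (e i)) (fderiv ℝ (fun y => fderiv ℝ H y (e j)) z v) +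
        inner ℝ (fderiv ℝ (fun y => fderiv ℝ H y (e i)) z v) (fderiv ℝ H z (e j))) i j) 0 := by
    intro i j
    simpa [gramAt] using (hd i).inner ℝ (hd j)
  refine (hasDerivAt_sqrt_det hg (by simpa using hdet)).congr_deriv ?_
  symm
  simp only [zero_smul, add_zero, Matrix.trace, Matrix.diag_apply, Matrix.mul_apply,
    Matrix.of_apply, mul_add, Finset.sum_add_distrib, Finset.mul_sum]
  -- The derivative of the metric has two terms that agree after exchanging indices, by symmetry of
  -- the inverse metric; together they cancel the factor `1/2` from the square root.
  have h1 : ∀ i j, volDensity H e z * (gramAt H e z)⁻¹ i j *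
      inner ℝ (fderiv ℝ (fun y => fderiv ℝ H y (e i)) z v) (fderiv ℝ H z (e j)) =
      √(gramAt H e z).det / 2 * ((gramAt H e z)⁻¹ i j *
        inner ℝ (fderiv ℝ H z (e j)) (fderiv ℝ (fun y => fderiv ℝ H y (e i)) z v)) +
      √(gramAt H e z).det / 2 * ((gramAt H e z)⁻¹ j i *
        inner ℝ (fderiv ℝ (fun y => fderiv ℝ H y (e i)) z v) (fderiv ℝ H z (e j))) := by
    intro i j
    rw [inv_gramAt_comm H e z j i, real_inner_comm (fderiv ℝ H z (e j)), volDensity]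
    ring
  simp_rw [h1, Finset.sum_add_distrib]
  congr 1
  exact Finset.sum_comm

theorem fderiv_conormal (hH : ContDiffAt ℝ ∞ H z) (hdet : 0 < (gramAt H e z).det) (i : ι)
    (v : Z) : fderiv ℝ (conormal H e i) z v =
      ∑ j, ((volDensity H e z * (gramAt H e z)⁻¹ i j) •
          fderiv ℝ (fun y => fderiv ℝ H y (e j)) z v +
        fderiv ℝ (fun y => volDensity H e y * (gramAt H e y)⁻¹ i j) z v •
          fderiv ℝ H z (e j)) := by
  refine fderiv_apply_eq_of_hasDerivAt_line
    ((contDiffAt_conormal hH hdet i).differentiableAt (by simp)) ?_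
  have := HasDerivAt.fun_sum (u := Finset.univ) fun j _ => (hasDerivAt_line
    ((contDiffAt_densCometric hH hdet i j).differentiableAt (by simp)) v).smul
      (hasDerivAt_line ((contDiffAt_fderiv_apply hH (e j)).differentiableAt (by simp)) v)
  simpa [conormal] using this

theorem eventually_det_gramAt_pos (hH : ContDiffAt ℝ ∞ H z) (hdet : 0 < (gramAt H e z).det) :
    ∀ᶠ y in 𝓝 z, 0 < (gramAt H e y).det := by
  have : ContDiffAt ℝ ∞ (fun y => (gramAt H e y).det) z :=
    contDiffWithinAt_det fun i j => contDiffAt_gramAt hH i j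
  exact this.continuousAt.eventually (lt_mem_nhds hdet)

/-- The divergence `∂_i (√det g g^{ij} ∂_j H)` is `√det g` times the mean curvature vector. -/
theorem sum_fderiv_conormal (hH : ContDiffAt ℝ ∞ H z) (hdet : 0 < (gramAt H e z).det) {v : V}
    (hv : ∀ i, inner ℝ v (fderiv ℝ H z (e i)) = 0)
    (hvn : ∀ ν : V, (∀ i, inner ℝ ν (fderiv ℝ H z (e i)) = 0) →
      inner ℝ v ν = ∑ i, ∑ j, (gramAt H e z)⁻¹ i j *
        inner ℝ (fderiv ℝ (fun y => fderiv ℝ H y (e j)) z (e i)) ν) :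
    ∑ i, fderiv ℝ (conormal H e i) z (e i) = volDensity H e z • v := by
  set P : ι → ι → ℝ := fun i j => volDensity H e z * (gramAt H e z)⁻¹ i j with hP
  set p : ι → ι → ℝ := fun i j =>
    fderiv ℝ (fun y => volDensity H e y * (gramAt H e y)⁻¹ i j) z (e i) with hp
  set D : ι → V := fun i => fderiv ℝ H z (e i) with hD
  set D2 : ι → ι → V := fun i j => fderiv ℝ (fun y => fderiv ℝ H y (e j)) z (e i) with hD2
  have hsum : ∑ i, fderiv ℝ (conormal H e i) z (e i) = ∑ i, ∑ j, (P i j • D2 i j + p i j • D j) :=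
    Finset.sum_congr rfl fun i _ => fderiv_conormal hH hdet i (e i)
  have hsymm : ∀ i j, D2 i j = D2 j i := fun i j => fderiv_fderiv_apply_comm hH (e j) (e i)
  have hPsymm : ∀ i j, P i j = P j i := fun i j => by simp [hP, inv_gramAt_comm H e z i j]
  have hw : ∀ k, fderiv ℝ (volDensity H e) z (e k) = ∑ i, ∑ j, P i j * inner ℝ (D2 k i) (D j) :=
    fun k => fderiv_volDensity hH hdet (e k)
  -- The identity `w g^{ij} g_{jk} = w δ_{ik}` is differentiated in two ways, here as a constant
  -- matrix times `w` and in `hPg'` by the product rule. This avoids a formula for the derivative of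
  -- the inverse metric.
  have hPg : ∀ i k, fderiv ℝ (fun y => ∑ j, volDensity H e y * (gramAt H e y)⁻¹ i j *
      gramAt H e y j k) z (e i) = if i = k then fderiv ℝ (volDensity H e) z (e k) else 0 := by
    intro i k
    have : (fun y => ∑ j, volDensity H e y * (gramAt H e y)⁻¹ i j * gramAt H e y j k) =ᶠ[𝓝 z]
        fun y => if i = k then volDensity H e y else 0 := by
      filter_upwards [eventually_det_gramAt_pos hH hdet] with y hy
      have h1 := congrFun₂ (Matrix.nonsing_inv_mul (gramAt H e y)
        (isUnit_iff_ne_zero.2 hy.ne')) i k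
      rw [Matrix.mul_apply, Matrix.one_apply] at h1
      simp_rw [mul_assoc, ← Finset.mul_sum, h1]
      simp
    rw [this.fderiv_eq]
    split_ifs with hik
    · subst hik; rfl
    · simp
  have hPg' : ∀ i k, fderiv ℝ (fun y => ∑ j, volDensity H e y * (gramAt H e y)⁻¹ i j *
      gramAt H e y j k) z (e i) = ∑ j, (p i j * inner ℝ (D j) (D k) +
        P i j * (inner ℝ (D j) (D2 i k) + inner ℝ (D2 i j) (D k))) := by
    intro i k
    have hPd := fun j => (contDiffAt_densCometric hH hdet i j).differentiableAt (by simp)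
    have hgd := fun j => (contDiffAt_gramAt (e := e) hH j k).differentiableAt (by simp)
    refine fderiv_apply_eq_of_hasDerivAt_line
      (DifferentiableAt.fun_sum fun j _ => (hPd j).mul (hgd j)) ?_
    have hd : ∀ j, HasDerivAt (fun s : ℝ => fderiv ℝ H (z + s • e i) (e j)) (D2 i j) 0 := fun j =>
      hasDerivAt_line ((contDiffAt_fderiv_apply hH (e j)).differentiableAt (by simp)) (e i)
    have := HasDerivAt.fun_sum (u := Finset.univ) fun j _ =>
      (hasDerivAt_line (hPd j) (e i)).mul ((hd j).inner ℝ (hd k))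
    refine this.congr_deriv ?_
    simp [hD, hP, hp]
  -- The divergence has no tangential part: equating the two derivatives of `w g^{ij} g_{jk}`, the
  -- terms `P i j * ⟨D j, D2 i k⟩` cancel against the first variation of `w`, by symmetry of second
  -- derivatives.
  have htan : ∀ k, inner ℝ (∑ i, ∑ j, (P i j • D2 i j + p i j • D j)) (D k) = 0 := by
    intro k
    have h1 : ∑ i, ∑ j, (p i j * inner ℝ (D j) (D k) +
        P i j * (inner ℝ (D j) (D2 i k) + inner ℝ (D2 i j) (D k))) =
        ∑ i, ∑ j, P i j * inner ℝ (D2 k i) (D j) := by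
      simp_rw [← hPg', hPg, ← hw]
      simp
    have h2 : ∑ i, ∑ j, P i j * inner ℝ (D j) (D2 i k) =
        ∑ i, ∑ j, P i j * inner ℝ (D2 k i) (D j) :=
      Finset.sum_congr rfl fun i _ => Finset.sum_congr rfl fun j _ => by
        rw [hsymm i k, real_inner_comm]
    simp only [mul_add, Finset.sum_add_distrib] at h1
    simp only [sum_inner, inner_add_left, inner_smul_left, RCLike.conj_to_real,
      Finset.sum_add_distrib]
    linarith
  rw [hsum]
  -- The difference of the two sides is normal, so `hvn` may be tested against it, which gives `⟨X,
  -- X⟩ = 0`. No normal field has to be chosen.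
  set X := (∑ i, ∑ j, (P i j • D2 i j + p i j • D j)) - volDensity H e z • v with hX
  have hXk : ∀ k, inner ℝ X (D k) = 0 := fun k => by
    rw [hX, inner_sub_left, htan, inner_smul_left, hv]; simp
  have hXX : inner ℝ X X = 0 := by
    nth_rewrite 1 [hX]
    rw [inner_sub_left, inner_smul_left, hvn X hXk]
    simp only [sum_inner, inner_add_left, inner_smul_left, RCLike.conj_to_real,
      real_inner_comm X (D _), hXk, mul_zero, add_zero, Finset.mul_sum, hP]
    rw [sub_eq_zero]
    refine Finset.sum_congr rfl fun i _ => Finset.sum_congr rfl fun j _ => ?_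
    rw [mul_assoc]
  exact sub_eq_zero.1 (inner_self_eq_zero.1 hXX)

/-- Evolution of the volume density under mean curvature flow. -/
theorem fderiv_volDensity_of_flow (hH : ContDiffAt ℝ ∞ H z) (hdet : 0 < (gramAt H e z).det)
    {e₀ : Z} (hv : ∀ᶠ y in 𝓝 z, ∀ i, inner ℝ (fderiv ℝ H y e₀) (fderiv ℝ H y (e i)) = 0)
    (hvn : inner ℝ (fderiv ℝ H z e₀) (fderiv ℝ H z e₀) = ∑ i, ∑ j, (gramAt H e z)⁻¹ i j *
        inner ℝ (fderiv ℝ (fun y => fderiv ℝ H y (e j)) z (e i)) (fderiv ℝ H z e₀)) :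
    fderiv ℝ (volDensity H e) z e₀ =
      -(volDensity H e z * ‖fderiv ℝ H z e₀‖ ^ 2) := by
  rw [fderiv_volDensity hH hdet, ← real_inner_self_eq_norm_sq, hvn, Finset.mul_sum,
    ← Finset.sum_neg_distrib]
  refine Finset.sum_congr rfl fun i _ => ?_
  rw [Finset.mul_sum, ← Finset.sum_neg_distrib]
  refine Finset.sum_congr rfl fun j _ => ?_
  -- Differentiating orthogonality of velocity and tangent vectors replaces `⟨∂_i v, ∂_j H⟩` by
  -- `-⟨v, ∂_i ∂_j H⟩`. This is why orthogonality is assumed on a neighbourhood and not only at `z`.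
  have h0 : fderiv ℝ (fun y => inner ℝ (fderiv ℝ H y e₀) (fderiv ℝ H y (e j))) z (e i) = 0 := by
    have : (fun y => inner ℝ (fderiv ℝ H y e₀) (fderiv ℝ H y (e j))) =ᶠ[𝓝 z] fun _ => (0 : ℝ) := by
      filter_upwards [hv] with y hy using hy j
    rw [this.fderiv_eq]; simp
  rw [fderiv_inner_apply (𝕜 := ℝ)
    ((contDiffAt_fderiv_apply hH e₀).differentiableAt (by simp))
    ((contDiffAt_fderiv_apply hH (e j)).differentiableAt (by simp))] at h0
  rw [fderiv_fderiv_apply_comm hH (e i) e₀,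
    real_inner_comm (fderiv ℝ H z e₀) (fderiv ℝ (fun y => fderiv ℝ H y (e j)) z (e i))]
  linear_combination (volDensity H e z * (gramAt H e z)⁻¹ i j) * h0

/-- The backward heat kernel (up to the factor `(4π)^{-n/2}`) along a parametrization `H`, where
`τ` is the time remaining. -/
def heatDensity (n : ℕ) (τ : Z → ℝ) (x₀ : V) (H : Z → V) (z : Z) : ℝ :=
  Real.exp (-(n / 2) * Real.log (τ z) - ‖H z - x₀‖ ^ 2 / (4 * τ z))

/-- The flux of the backward heat kernel along a parametrization. -/
def heatFlux (n : ℕ) (τ : Z → ℝ) (x₀ : V) (H : Z → V) (e : ι → Z) (i : ι) (z : Z) : ℝ :=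
  -(heatDensity n τ x₀ H z / (2 * τ z)) * inner ℝ (H z - x₀) (conormal H e i z)

theorem contDiffAt_heatDensity (n : ℕ) {τ : Z → ℝ} (x₀ : V) (hH : ContDiffAt ℝ ∞ H z)
    (hτ : ContDiffAt ℝ ∞ τ z) (hτz : 0 < τ z) :
    ContDiffAt ℝ ∞ (heatDensity n τ x₀ H) z :=
  ((contDiffAt_const.mul (hτ.log hτz.ne')).sub (((hH.sub contDiffAt_const).norm_sq ℝ).div
    (contDiffAt_const.mul hτ) (by positivity))).exp

theorem contDiffAt_heatFlux (n : ℕ) {τ : Z → ℝ} (x₀ : V) (hH : ContDiffAt ℝ ∞ H z)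
    (hdet : 0 < (gramAt H e z).det) (hτ : ContDiffAt ℝ ∞ τ z) (hτz : 0 < τ z) (i : ι) :
    ContDiffAt ℝ ∞ (heatFlux n τ x₀ H e i) z :=
  ((contDiffAt_heatDensity n x₀ hH hτ hτz).div (contDiffAt_const.mul hτ) (by positivity)).neg.mul
    ((hH.sub contDiffAt_const).inner ℝ (contDiffAt_conormal hH hdet i))

theorem fderiv_heatDensity (n : ℕ) {τ : Z → ℝ} (x₀ : V) (hH : ContDiffAt ℝ ∞ H z)
    (hτ : ContDiffAt ℝ ∞ τ z) (hτz : 0 < τ z) (v : Z) :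
    fderiv ℝ (heatDensity n τ x₀ H) z v = heatDensity n τ x₀ H z *
      (-(n / 2) * fderiv ℝ τ z v / τ z - inner ℝ (H z - x₀) (fderiv ℝ H z v) / (2 * τ z) +
        ‖H z - x₀‖ ^ 2 * fderiv ℝ τ z v / (4 * τ z ^ 2)) := by
  refine fderiv_apply_eq_of_hasDerivAt_line
    ((contDiffAt_heatDensity n x₀ hH hτ hτz).differentiableAt (by simp)) ?_
  have h1 := hasDerivAt_line (hτ.differentiableAt (by simp)) v
  have h2 := (hasDerivAt_line (hH.differentiableAt (by simp)) v).sub_const x₀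
  have h3 := (((h1.log (by simpa using hτz.ne')).const_mul (-(n / 2 : ℝ))).sub
    (h2.norm_sq.div (h1.const_mul 4) (by simpa using hτz.ne'))).exp
  refine h3.congr_deriv ?_
  simp only [zero_smul, add_zero, heatDensity, Pi.sub_apply, Pi.div_apply]
  congr 1
  field_simp
  ring

/-- The pointwise form of **Huisken's monotonicity formula**. -/
theorem fderiv_heatDensity_mul_volDensity_add_le {τ : Z → ℝ} (x₀ : V) (hH : ContDiffAt ℝ ∞ H z)
    (hdet : 0 < (gramAt H e z).det) (hτ : ContDiffAt ℝ ∞ τ z) (hτz : 0 < τ z) {e₀ : Z}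
    (hτ0 : fderiv ℝ τ z e₀ = -1) (hτi : ∀ i, fderiv ℝ τ z (e i) = 0)
    (hv : ∀ᶠ y in 𝓝 z, ∀ i, inner ℝ (fderiv ℝ H y e₀) (fderiv ℝ H y (e i)) = 0)
    (hvn : ∀ ν : V, (∀ i, inner ℝ ν (fderiv ℝ H z (e i)) = 0) →
      inner ℝ (fderiv ℝ H z e₀) ν = ∑ i, ∑ j, (gramAt H e z)⁻¹ i j *
        inner ℝ (fderiv ℝ (fun y => fderiv ℝ H y (e j)) z (e i)) ν) :
    fderiv ℝ (fun y => heatDensity (Fintype.card ι) τ x₀ H y * volDensity H e y) z e₀ +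
      ∑ i, fderiv ℝ (heatFlux (Fintype.card ι) τ x₀ H e i) z (e i) ≤ 0 := by
  set n := Fintype.card ι with hn
  set Φ := heatDensity n τ x₀ H z with hΦ
  set w := volDensity H e z with hw
  set v := fderiv ℝ H z e₀ with hvdef
  set r := H z - x₀ with hr
  set t := τ z with ht
  have hvz : ∀ i, inner ℝ v (fderiv ℝ H z (e i)) = 0 := hv.self_of_nhds
  have hΦpos : 0 < Φ := Real.exp_pos _
  have hwpos : 0 < w := Real.sqrt_pos.2 hdet
  have dΦ : DifferentiableAt ℝ (heatDensity n τ x₀ H) z :=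
    (contDiffAt_heatDensity n x₀ hH hτ hτz).differentiableAt (by simp)
  have dw : DifferentiableAt ℝ (volDensity H e) z :=
    (contDiffAt_volDensity hH hdet).differentiableAt (by simp)
  have dH : DifferentiableAt ℝ H z := hH.differentiableAt (by simp)
  have dτ : DifferentiableAt ℝ τ z := hτ.differentiableAt (by simp)
  have dY : ∀ i, DifferentiableAt ℝ (conormal H e i) z := fun i =>
    (contDiffAt_conormal hH hdet i).differentiableAt (by simp)
  have h0 : fderiv ℝ (fun y => heatDensity n τ x₀ H y * volDensity H e y) z e₀ =
      Φ * (n / (2 * t) - inner ℝ r v / (2 * t) - ‖r‖ ^ 2 / (4 * t ^ 2)) * w +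
        Φ * -(w * ‖v‖ ^ 2) := by
    refine fderiv_apply_eq_of_hasDerivAt_line (dΦ.mul dw) ?_
    refine ((hasDerivAt_line dΦ e₀).mul (hasDerivAt_line dw e₀)).congr_deriv ?_
    rw [fderiv_volDensity_of_flow hH hdet hv (hvn v hvz),
      fderiv_heatDensity n x₀ hH hτ hτz, hτ0]
    simp only [zero_smul, add_zero]
    ring
  have hi : ∀ i, fderiv ℝ (heatFlux n τ x₀ H e i) z (e i) =
      Φ * inner ℝ r (fderiv ℝ H z (e i)) / (4 * t ^ 2) * inner ℝ r (conormal H e i z) -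
      Φ / (2 * t) * (inner ℝ r (fderiv ℝ (conormal H e i) z (e i)) +
        inner ℝ (fderiv ℝ H z (e i)) (conormal H e i z)) := by
    intro i
    refine fderiv_apply_eq_of_hasDerivAt_line
      ((contDiffAt_heatFlux n x₀ hH hdet hτ hτz i).differentiableAt (by simp)) ?_
    have h1 := hasDerivAt_line dτ (e i)
    rw [hτi] at h1
    refine ((((hasDerivAt_line dΦ (e i)).div (h1.const_mul 2)
      (by simpa using hτz.ne')).neg).mul (((hasDerivAt_line dH (e i)).sub_const x₀).inner ℝ
        (hasDerivAt_line (dY i) (e i)))).congr_deriv ?_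
    rw [fderiv_heatDensity n x₀ hH hτ hτz, hτi]
    simp only [zero_smul, add_zero, Pi.div_apply, Pi.neg_apply, ← hr, ← hΦ, ← ht]
    field_simp
    ring
  have hdiv : ∑ i, inner ℝ r (fderiv ℝ (conormal H e i) z (e i)) = w * inner ℝ r v := by
    rw [← inner_sum, sum_fderiv_conormal hH hdet hvz hvn, inner_smul_right]
  -- The trace of the metric against its inverse is the dimension; this term cancels the derivative
  -- of `τ^{-n/2}` in the kernel.
  have htr : ∑ i, inner ℝ (fderiv ℝ H z (e i)) (conormal H e i z) = w * n := by
    have : ∀ i, inner ℝ (fderiv ℝ H z (e i)) (conormal H e i z) = w * 1 := by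
      intro i
      have h1 := congrFun₂ (Matrix.nonsing_inv_mul (gramAt H e z)
        (isUnit_iff_ne_zero.2 hdet.ne')) i i
      rw [Matrix.mul_apply, Matrix.one_apply_eq] at h1
      rw [← h1]
      simp only [conormal, inner_sum, inner_smul_right, Finset.mul_sum, gramAt, Matrix.gram_apply]
      refine Finset.sum_congr rfl fun j _ => ?_
      rw [real_inner_comm (fderiv ℝ H z (e j)), mul_assoc]
    simp [this, hn, mul_comm]
  set Q := ∑ i, ∑ j, (gramAt H e z)⁻¹ i j *
    (inner ℝ r (fderiv ℝ H z (e i)) * inner ℝ r (fderiv ℝ H z (e j))) with hQ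
  have hQ' : ∑ i, inner ℝ r (fderiv ℝ H z (e i)) * inner ℝ r (conormal H e i z) = w * Q := by
    simp only [conormal, inner_sum, inner_smul_right, Finset.mul_sum, hQ]
    refine Finset.sum_congr rfl fun i _ => Finset.sum_congr rfl fun j _ => ?_
    rw [← hw]; ring
  -- Since `v` is normal, `r + 2tv` and `r` have the same tangential part, whose squared length is
  -- `Q`. Bessel's inequality therefore applies to the shifted vector.
  have hB : Q ≤ ‖r + (2 * t) • v‖ ^ 2 := by
    have := sum_inv_gram_mul_inner_le (fun i => fderiv ℝ H z (e i)) hdet.ne' (r + (2 * t) • v)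
    simp only [inner_add_left, inner_smul_left, hvz, mul_zero, add_zero] at this
    exact this
  rw [norm_add_sq_real, inner_smul_right, norm_smul, mul_pow, Real.norm_eq_abs, sq_abs] at hB
  have hsum : ∑ i, fderiv ℝ (heatFlux n τ x₀ H e i) z (e i) =
      Φ / (4 * t ^ 2) * (w * Q) - Φ / (2 * t) * (w * inner ℝ r v + w * n) := by
    rw [← hQ', ← hdiv, ← htr, ← Finset.sum_add_distrib, Finset.mul_sum, Finset.mul_sum,
      ← Finset.sum_sub_distrib]
    refine Finset.sum_congr rfl fun i _ => ?_
    rw [hi]; ring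
  rw [h0, hsum]
  -- Completing the square: the total is a negative multiple of `‖r + 2tv‖² - Q`, the squared length
  -- of the normal part of `r + 2tv`.
  have hfin : Φ * (n / (2 * t) - inner ℝ r v / (2 * t) - ‖r‖ ^ 2 / (4 * t ^ 2)) * w +
      Φ * -(w * ‖v‖ ^ 2) + (Φ / (4 * t ^ 2) * (w * Q) -
        Φ / (2 * t) * (w * inner ℝ r v + w * n)) =
      -(Φ * w / (4 * t ^ 2)) *
        (‖r‖ ^ 2 + 2 * (2 * t * inner ℝ r v) + (2 * t) ^ 2 * ‖v‖ ^ 2 - Q) := by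
    field_simp
    ring
  rw [hfin]
  have : 0 ≤ Φ * w / (4 * t ^ 2) := by positivity
  nlinarith

end Calculus

end MCF

end

noncomputable section

namespace MCF

/-! ### Coordinate independence of metric traces. -/

section MetricTrace

variable {ι E V : Type*} [Fintype ι] [DecidableEq ι] [AddCommGroup E] [Module ℝ E]
  [NormedAddCommGroup V] [InnerProductSpace ℝ V]

/-- The metric trace `g^{ij} β_{ij}` of a bilinear form does not depend on coordinates. -/
theorem sum_inv_gram_mul_comp (b : Module.Basis ι ℝ E) (L : E →ₗ[ℝ] V)
    (β : LinearMap.BilinForm ℝ E) (A : E →ₗ[ℝ] E)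
    (hdet : (Matrix.gram ℝ fun i => L (A (b i))).det ≠ 0) :
    ∑ i, ∑ j, (Matrix.gram ℝ fun i => L (A (b i)))⁻¹ i j * β (A (b i)) (A (b j)) =
      ∑ i, ∑ j, (Matrix.gram ℝ fun i => L (b i))⁻¹ i j * β (b i) (b j) := by
  set γ : LinearMap.BilinForm ℝ E := LinearMap.BilinForm.comp (innerₗ V) L L with hγ
  set a := LinearMap.toMatrix b b A
  -- Both the metric and the form transform as `aᵀ · a`, so the inverse metric times the transposed
  -- form is conjugated by `a` and keeps its trace.
  have hmat : ∀ κ : LinearMap.BilinForm ℝ E, LinearMap.BilinForm.toMatrix b (κ.comp A A) =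
      a.transpose * LinearMap.BilinForm.toMatrix b κ * a := fun κ =>
    LinearMap.BilinForm.toMatrix_comp b b κ A A
  have hG : (Matrix.gram ℝ fun i => L (b i)) = LinearMap.BilinForm.toMatrix b γ := by
    ext i j; simp [hγ, LinearMap.BilinForm.toMatrix_apply]
  have hG2 : (Matrix.gram ℝ fun i => L (A (b i))) =
      LinearMap.BilinForm.toMatrix b (γ.comp A A) := by
    ext i j; simp [hγ, LinearMap.BilinForm.toMatrix_apply]
  have hsum : ∀ (M : Matrix ι ι ℝ) (κ : LinearMap.BilinForm ℝ E),
      ∑ i, ∑ j, M i j * κ (b i) (b j) =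
        (M * (LinearMap.BilinForm.toMatrix b κ).transpose).trace := by
    intro M κ
    simp [Matrix.trace, Matrix.mul_apply, LinearMap.BilinForm.toMatrix_apply]
  have h1 := hsum (Matrix.gram ℝ fun i => L (A (b i)))⁻¹ (β.comp A A)
  simp only [LinearMap.BilinForm.comp_apply] at h1
  rw [h1, hsum, hmat, hG, hG2, hmat]
  rw [hG2, hmat, Matrix.det_mul, Matrix.det_mul, Matrix.det_transpose] at hdet
  have ha : IsUnit a.det := isUnit_iff_ne_zero.2 fun h => hdet (by rw [h, mul_zero])
  have hat : IsUnit a.transpose.det := by rwa [Matrix.det_transpose]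
  rw [Matrix.mul_inv_rev, Matrix.mul_inv_rev, Matrix.transpose_mul, Matrix.transpose_mul,
    Matrix.transpose_transpose, Matrix.mul_assoc, Matrix.trace_mul_comm]
  congr 1
  simp only [Matrix.mul_assoc]
  rw [Matrix.mul_nonsing_inv a ha, Matrix.mul_one, Matrix.nonsing_inv_mul_cancel_left _ _ hat]

end MetricTrace

/-! ### Second derivatives under a change of coordinates. -/

section SecondDerivative

variable {E F V : Type*} [NormedAddCommGroup E] [NormedSpace ℝ E] [NormedAddCommGroup F]
  [NormedSpace ℝ F] [NormedAddCommGroup V] [InnerProductSpace ℝ V]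

theorem fderiv_fderiv_apply {h : E → V} {u : E} (hh : ContDiffAt ℝ ∞ h u) (v w : E) :
    fderiv ℝ (fun y => fderiv ℝ h y w) u v = fderiv ℝ (fderiv ℝ h) u v w := by
  rw [fderiv_clm_apply ((hh.fderiv_right (m := ∞) (by simp)).differentiableAt (by simp))
    (differentiableAt_const w)]
  simp

/-- The normal part of the second derivative transforms as a tensor. -/
theorem inner_fderiv_fderiv_comp {h : F → V} {θ : E → F} {u : E}
    (hθ : ContDiffAt ℝ ∞ θ u) (hh : ContDiffAt ℝ ∞ h (θ u)) {ν : V}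
    (hν : ∀ w, inner ℝ ν (fderiv ℝ h (θ u) w) = 0) (v w : E) :
    inner ℝ (fderiv ℝ (fderiv ℝ (h ∘ θ)) u v w) ν =
      inner ℝ (fderiv ℝ (fderiv ℝ h) (θ u) (fderiv ℝ θ u v) (fderiv ℝ θ u w)) ν := by
  have hne : (∞ : WithTop ℕ∞) ≠ 0 := by simp
  have hev : (fun y => fderiv ℝ (h ∘ θ) y w) =ᶠ[𝓝 u]
      fun y => fderiv ℝ h (θ y) (fderiv ℝ θ y w) := by
    have h1 : ∀ᶠ y in 𝓝 u, ContDiffAt ℝ 1 θ y :=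
      (hθ.of_le (by exact_mod_cast le_top)).eventually (by simp)
    have h2 : ∀ᶠ y in 𝓝 u, ContDiffAt ℝ 1 h (θ y) := hθ.continuousAt.eventually
      ((hh.of_le (by exact_mod_cast le_top)).eventually (by simp))
    filter_upwards [h1, h2] with y hy1 hy2
    rw [fderiv_comp y (hy2.differentiableAt one_ne_zero) (hy1.differentiableAt one_ne_zero)]
    rfl
  have hdh : DifferentiableAt ℝ (fderiv ℝ h) (θ u) :=
    (hh.fderiv_right (m := ∞) (by simp)).differentiableAt hne
  have hdθ : DifferentiableAt ℝ θ u := hθ.differentiableAt hne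
  have hdθ' : DifferentiableAt ℝ (fun y => fderiv ℝ θ y w) u :=
    ((hθ.fderiv_right (m := ∞) (by simp)).differentiableAt hne).clm_apply
      (differentiableAt_const w)
  rw [← fderiv_fderiv_apply (hh.comp u hθ), hev.fderiv_eq,
    fderiv_clm_apply (c := fun y => fderiv ℝ h (θ y)) (hdh.comp u hdθ) hdθ',
    fderiv_fun_comp u hdh hdθ]
  -- The additional term of the chain rule, the first derivative of `h` applied to the second
  -- derivative of `θ`, is tangential and so orthogonal to `ν`.
  simp [inner_add_left, real_inner_comm, hν]

end SecondDerivative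

/-! ### Hypersurfaces and mean curvature in an arbitrary chart. -/

section Charts

theorem det_gram_pos {E V : Type*} [NormedAddCommGroup E] [InnerProductSpace ℝ E]
    [FiniteDimensional ℝ E] [NormedAddCommGroup V] [InnerProductSpace ℝ V] {ι : Type*} [Fintype ι]
    [DecidableEq ι] {L : E →L[ℝ] V} (hL : Function.Injective L) (b : OrthonormalBasis ι ℝ E) :
    0 < (Matrix.gram ℝ fun i => L (b i)).det := by
  have := normDet_pos hL
  rwa [normDet_eq_sqrt_det_gram L b, Real.sqrt_pos] at this

variable {n : ℕ} {N : Type*} [TopologicalSpace N] [ChartedSpace (EuclideanSpace ℝ (Fin n)) N]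
  {W : Type*} [NormedAddCommGroup W] [NormedSpace ℝ W]

/-- The coordinate change from the chart at `p` to the one at `q`. -/
def coordChange (n : ℕ) {N : Type*} [TopologicalSpace N]
    [ChartedSpace (EuclideanSpace ℝ (Fin n)) N] (p q : N) :
    EuclideanSpace ℝ (Fin n) → EuclideanSpace ℝ (Fin n) :=
  extChartAt (𝓡 n) q ∘ (extChartAt (𝓡 n) p).symm

theorem comp_extChartAt_symm_eventuallyEq {X : Type*} (f : N → X) {p q : N}
    {u : EuclideanSpace ℝ (Fin n)} (hu : u ∈ (extChartAt (𝓡 n) p).target)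
    (hq : (extChartAt (𝓡 n) p).symm u ∈ (extChartAt (𝓡 n) q).source) :
    f ∘ (extChartAt (𝓡 n) p).symm =ᶠ[𝓝 u]
      (f ∘ (extChartAt (𝓡 n) q).symm) ∘ coordChange n p q := by
  have h1 : ContinuousAt (extChartAt (𝓡 n) p).symm u :=
    (continuousOn_extChartAt_symm p).continuousAt ((isOpen_extChartAt_target p).mem_nhds hu)
  filter_upwards [h1.preimage_mem_nhds ((isOpen_extChartAt_source q).mem_nhds hq)] with y hy
  simp only [coordChange, Function.comp_apply]
  rw [(extChartAt (𝓡 n) q).left_inv hy]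

variable [IsManifold (𝓡 n) ∞ N]

theorem contDiffOn_comp_extChartAt_symm {f : N → W} (hf : ContMDiff (𝓡 n) 𝓘(ℝ, W) ∞ f) (p : N) :
    ContDiffOn ℝ ∞ (f ∘ (extChartAt (𝓡 n) p).symm) (extChartAt (𝓡 n) p).target :=
  (hf.comp_contMDiffOn (contMDiffOn_extChartAt_symm p)).contDiffOn

theorem contDiffAt_comp_extChartAt_symm {f : N → W} (hf : ContMDiff (𝓡 n) 𝓘(ℝ, W) ∞ f) (p : N)
    {u : EuclideanSpace ℝ (Fin n)} (hu : u ∈ (extChartAt (𝓡 n) p).target) :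
    ContDiffAt ℝ ∞ (f ∘ (extChartAt (𝓡 n) p).symm) u :=
  (contDiffOn_comp_extChartAt_symm hf p).contDiffAt ((isOpen_extChartAt_target p).mem_nhds hu)

theorem contDiffAt_coordChange {p q : N} {u : EuclideanSpace ℝ (Fin n)}
    (hu : u ∈ (extChartAt (𝓡 n) p).target)
    (hq : (extChartAt (𝓡 n) p).symm u ∈ (extChartAt (𝓡 n) q).source) :
    ContDiffAt ℝ ∞ (coordChange n p q) u := by
  have h1 : ContMDiffAt 𝓘(ℝ, EuclideanSpace ℝ (Fin n)) (𝓡 n) ∞ (extChartAt (𝓡 n) p).symm u :=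
    (contMDiffOn_extChartAt_symm p).contMDiffAt ((isOpen_extChartAt_target p).mem_nhds hu)
  have h2 : ContMDiffAt (𝓡 n) 𝓘(ℝ, EuclideanSpace ℝ (Fin n)) ∞ (extChartAt (𝓡 n) q)
      ((extChartAt (𝓡 n) p).symm u) :=
    contMDiffAt_extChartAt' (by rwa [extChartAt_source] at hq)
  exact (h2.comp u h1).contDiffAt

/-- The derivative of `f` in a chart has the same range as the derivative of `f`. -/
theorem exists_fderiv_comp_extChartAt_symm {f : N → W} (hf : ContMDiff (𝓡 n) 𝓘(ℝ, W) ∞ f)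
    {p : N} {u : EuclideanSpace ℝ (Fin n)} (hu : u ∈ (extChartAt (𝓡 n) p).target) :
    ∃ B : EuclideanSpace ℝ (Fin n) ≃L[ℝ] EuclideanSpace ℝ (Fin n),
      ∀ v, fderiv ℝ (f ∘ (extChartAt (𝓡 n) p).symm) u v =
        mfderiv (𝓡 n) 𝓘(ℝ, W) f ((extChartAt (𝓡 n) p).symm u) (B v) := by
  have : IsManifold (𝓡 n) 1 N := IsManifold.of_le (n := ∞) (by exact_mod_cast le_top)
  obtain ⟨B, hB⟩ := isInvertible_mfderivWithin_extChartAt_symm (I := 𝓡 n) hu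
  have hr : Set.range (𝓡 n) = Set.univ := ModelWithCorners.range_eq_univ _
  rw [hr, mfderivWithin_univ] at hB
  refine ⟨B, fun v => ?_⟩
  have h1 : MDifferentiableAt 𝓘(ℝ, EuclideanSpace ℝ (Fin n)) (𝓡 n) (extChartAt (𝓡 n) p).symm u :=
    ((contMDiffOn_extChartAt_symm p).contMDiffAt
      ((isOpen_extChartAt_target p).mem_nhds hu)).mdifferentiableAt (n := ∞) (by simp)
  have h2 := mfderiv_comp u (hf.mdifferentiable (by simp) _) h1
  rw [← mfderiv_eq_fderiv, h2, ← hB]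
  rfl

theorem injective_fderiv_localParam {f : N → Ambient n} (hf : IsEmbeddedHypersurface f) {p : N}
    {u : EuclideanSpace ℝ (Fin n)} (hu : u ∈ (extChartAt (𝓡 n) p).target) :
    Function.Injective (fderiv ℝ (localParam f p) u) := by
  obtain ⟨B, hB⟩ := exists_fderiv_comp_extChartAt_symm hf.smooth hu
  intro v w hvw
  exact B.injective (hf.immersion _ ((hB v).symm.trans (hvw.trans (hB w))))

/-- A coordinate-independent form of a metric trace on a hypersurface. -/
theorem sum_inv_gram_localParam_eq {f : N → Ambient n} (hf : IsEmbeddedHypersurface f) {p q : N}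
    {u : EuclideanSpace ℝ (Fin n)} (hu : u ∈ (extChartAt (𝓡 n) p).target)
    (hq : (extChartAt (𝓡 n) p).symm u ∈ (extChartAt (𝓡 n) q).source)
    (β : LinearMap.BilinForm ℝ (EuclideanSpace ℝ (Fin n))) :
    ∑ i, ∑ j, (Matrix.gram ℝ fun i => fderiv ℝ (localParam f p) u
        (EuclideanSpace.single i 1))⁻¹ i j *
      β (fderiv ℝ (coordChange n p q) u (EuclideanSpace.single i 1))
        (fderiv ℝ (coordChange n p q) u (EuclideanSpace.single j 1)) =
    ∑ i, ∑ j, (Matrix.gram ℝ fun i => fderiv ℝ (localParam f q) (coordChange n p q u)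
        (EuclideanSpace.single i 1))⁻¹ i j *
      β (EuclideanSpace.single i 1) (EuclideanSpace.single j 1) := by
  set b := EuclideanSpace.basisFun (Fin n) ℝ
  have hcomp : fderiv ℝ (localParam f p) u =
      (fderiv ℝ (localParam f q) (coordChange n p q u)).comp (fderiv ℝ (coordChange n p q) u) := by
    have h1 := (comp_extChartAt_symm_eventuallyEq f hu hq).fderiv_eq (𝕜 := ℝ)
    have hq' : coordChange n p q u ∈ (extChartAt (𝓡 n) q).target :=
      (extChartAt (𝓡 n) q).map_source hq
    rw [fderiv_comp u ((contDiffAt_comp_extChartAt_symm hf.smooth q hq').differentiableAt (by simp))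
      ((contDiffAt_coordChange hu hq).differentiableAt (by simp))] at h1
    exact h1
  have hdet := det_gram_pos (injective_fderiv_localParam hf hu) b
  rw [hcomp] at hdet ⊢
  have := sum_inv_gram_mul_comp b.toBasis
    (fderiv ℝ (localParam f q) (coordChange n p q u) : _ →ₗ[ℝ] Ambient n) β
    (fderiv ℝ (coordChange n p q) u : _ →ₗ[ℝ] _) (by simpa [b] using hdet.ne')
  simpa [b] using this

/-- The mean curvature computed in an arbitrary chart. -/
theorem meanCurvature_eq_of_mem_target {f : N → Ambient n} (hf : IsEmbeddedHypersurface f) {p : N}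
    {u : EuclideanSpace ℝ (Fin n)} (hu : u ∈ (extChartAt (𝓡 n) p).target) {ν : Ambient n}
    (hν : IsUnitNormal f ((extChartAt (𝓡 n) p).symm u) ν) :
    meanCurvature f ((extChartAt (𝓡 n) p).symm u) ν =
      -∑ i, ∑ j, (Matrix.gram ℝ fun i => fderiv ℝ (localParam f p) u
        (EuclideanSpace.single i 1))⁻¹ i j * inner ℝ (fderiv ℝ (fderiv ℝ (localParam f p)) u
          (EuclideanSpace.single i 1) (EuclideanSpace.single j 1)) ν := by
  -- The mean curvature at `q` is defined in the preferred chart at `q`, which varies with the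
  -- point. Differentiation needs the fixed chart at `p`, so the two are compared through the
  -- transition map.
  set q := (extChartAt (𝓡 n) p).symm u with hqdef
  have hq : q ∈ (extChartAt (𝓡 n) q).source := mem_extChartAt_source q
  have hθu : coordChange n p q u = extChartAt (𝓡 n) q q := rfl
  have hqt : coordChange n p q u ∈ (extChartAt (𝓡 n) q).target :=
    (extChartAt (𝓡 n) q).map_source hq
  have hh : ContDiffAt ℝ ∞ (localParam f q) (coordChange n p q u) :=
    contDiffAt_comp_extChartAt_symm hf.smooth q hqt
  set β : LinearMap.BilinForm ℝ (EuclideanSpace ℝ (Fin n)) :=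
    LinearMap.mk₂ ℝ (fun v w => inner ℝ (fderiv ℝ (fderiv ℝ (localParam f q))
      (coordChange n p q u) v w) ν)
      (fun _ _ _ => by simp [inner_add_left]) (fun _ _ _ => by simp [inner_smul_left])
      (fun _ _ _ => by simp [inner_add_left]) (fun _ _ _ => by simp [inner_smul_left]) with hβ
  have hνq : ∀ w, inner ℝ ν (fderiv ℝ (localParam f q) (coordChange n p q u) w) = 0 := by
    intro w
    obtain ⟨B, hB⟩ := exists_fderiv_comp_extChartAt_symm hf.smooth hqt
    have h1 := hB w
    have h2 : (extChartAt (𝓡 n) q).symm (coordChange n p q u) = q :=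
      (extChartAt (𝓡 n) q).left_inv hq
    rw [h2] at h1
    exact (congrArg (inner ℝ ν) h1).trans (hν.2 (B w))
  have hev : fderiv ℝ (localParam f p) =ᶠ[𝓝 u]
      fderiv ℝ (localParam f q ∘ coordChange n p q) :=
    (comp_extChartAt_symm_eventuallyEq f hu hq).fderiv
  have h2 : ∀ i j : Fin n, inner ℝ (fderiv ℝ (fderiv ℝ (localParam f p)) u
      (EuclideanSpace.single i 1) (EuclideanSpace.single j 1)) ν =
      β (fderiv ℝ (coordChange n p q) u (EuclideanSpace.single i 1))
        (fderiv ℝ (coordChange n p q) u (EuclideanSpace.single j 1)) := by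
    intro i j
    rw [hev.fderiv_eq, inner_fderiv_fderiv_comp (contDiffAt_coordChange hu hq) hh hνq]
    rfl
  simp_rw [h2]
  rw [sum_inv_gram_localParam_eq hf hu hq β]
  rfl

end Charts

end MCF

end

noncomputable section

namespace MCF

/-! ### The mean curvature flow equation in a fixed space-time chart. -/

section Flow

open Set

variable {n : ℕ} {N : Type*} [TopologicalSpace N] [ChartedSpace (EuclideanSpace ℝ (Fin n)) N]

/-- A family of maps in the chart at `p`, as a function of time and position. -/
def flowParam (F : ℝ → N → Ambient n) (p : N) (z : ℝ × EuclideanSpace ℝ (Fin n)) : Ambient n :=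
  F z.1 ((extChartAt (𝓡 n) p).symm z.2)

/-- The coordinate directions in space-time. -/
def spaceVec (n : ℕ) (i : Fin n) : ℝ × EuclideanSpace ℝ (Fin n) := (0, EuclideanSpace.single i 1)

/-- The time direction in space-time. -/
def timeVec (n : ℕ) : ℝ × EuclideanSpace ℝ (Fin n) := (1, 0)

theorem inner_eq_zero_of_forall_single {V : Type*} [NormedAddCommGroup V] [InnerProductSpace ℝ V]
    {L : EuclideanSpace ℝ (Fin n) →L[ℝ] V} {ν : V}
    (h : ∀ i, inner ℝ ν (L (EuclideanSpace.single i 1)) = 0) (w : EuclideanSpace ℝ (Fin n)) :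
    inner ℝ ν (L w) = 0 := by
  rw [← (EuclideanSpace.basisFun (Fin n) ℝ).sum_repr w]
  simp [inner_sum, inner_smul_right, h]

variable [IsManifold (𝓡 n) ∞ N]

theorem isUnitNormal_iff {f : N → Ambient n} (hf : ContMDiff (𝓡 n) 𝓘(ℝ, Ambient n) ∞ f) {p : N}
    {u : EuclideanSpace ℝ (Fin n)} (hu : u ∈ (extChartAt (𝓡 n) p).target) {ν : Ambient n} :
    IsUnitNormal f ((extChartAt (𝓡 n) p).symm u) ν ↔ ‖ν‖ = 1 ∧
      ∀ i, inner ℝ ν (fderiv ℝ (localParam f p) u (EuclideanSpace.single i 1)) = 0 := by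
  obtain ⟨B, hB⟩ := exists_fderiv_comp_extChartAt_symm hf hu
  refine ⟨fun h => ⟨h.1, fun i => ?_⟩, fun h => ⟨h.1, fun v => ?_⟩⟩
  · exact (congrArg (inner ℝ ν) (hB _)).trans (h.2 _)
  · have h1 := inner_eq_zero_of_forall_single h.2 (B.symm v)
    have h2 : fderiv ℝ (localParam f p) u (B.symm v) = mfderiv (𝓡 n) 𝓘(ℝ, Ambient n) f
        ((extChartAt (𝓡 n) p).symm u) v :=
      (hB (B.symm v)).trans (congrArg _ (B.apply_symm_apply v))
    exact (congrArg (inner ℝ ν) h2).symm.trans h1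

/-- The tangent space has dimension at most `n`, so its orthogonal complement in `ℝ^{n+1}` is
non-zero. The flow equation is quantified over unit normals, so one is needed to extract the
velocity. -/
theorem exists_isUnitNormal {f : N → Ambient n} (hf : ContMDiff (𝓡 n) 𝓘(ℝ, Ambient n) ∞ f) {p : N}
    {u : EuclideanSpace ℝ (Fin n)} (hu : u ∈ (extChartAt (𝓡 n) p).target) :
    ∃ ν, IsUnitNormal f ((extChartAt (𝓡 n) p).symm u) ν := by
  set L : EuclideanSpace ℝ (Fin n) →ₗ[ℝ] Ambient n :=
    (fderiv ℝ (localParam f p) u).toLinearMap with hL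
  have hne : LinearMap.range L ≠ ⊤ := by
    intro h
    have h1 := LinearMap.finrank_range_le L
    rw [h, finrank_top] at h1
    simp at h1
  have hbot : (LinearMap.range L)ᗮ ≠ ⊥ := fun h => hne ((Submodule.orthogonal_eq_bot_iff).1 h)
  obtain ⟨x, hx, hx0⟩ := Submodule.exists_mem_ne_zero_of_ne_bot hbot
  refine ⟨‖x‖⁻¹ • x, (isUnitNormal_iff hf hu).2 ⟨?_, fun i => ?_⟩⟩
  · rw [norm_smul, norm_inv, norm_norm, inv_mul_cancel₀ (norm_ne_zero_iff.2 hx0)]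
  · have := (Submodule.mem_orthogonal' _ x).1 hx (L (EuclideanSpace.single i 1))
      (LinearMap.mem_range_self L _)
    rw [inner_smul_left]
    exact mul_eq_zero_of_right _ this

variable {t₀ t₁ : ℝ} {F : ℝ → N → Ambient n}

theorem contDiffOn_flowParam (hF : IsMeanCurvatureFlow t₀ t₁ F) (p : N) :
    ContDiffOn ℝ ∞ (flowParam F p) (Ico t₀ t₁ ×ˢ (extChartAt (𝓡 n) p).target) := by
  have h1 : ContMDiffOn (𝓘(ℝ, ℝ).prod 𝓘(ℝ, EuclideanSpace ℝ (Fin n))) (𝓘(ℝ, ℝ).prod (𝓡 n)) ∞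
      (fun z : ℝ × EuclideanSpace ℝ (Fin n) => (z.1, (extChartAt (𝓡 n) p).symm z.2))
      (Ico t₀ t₁ ×ˢ (extChartAt (𝓡 n) p).target) :=
    contMDiffOn_fst.prodMk ((contMDiffOn_extChartAt_symm p).comp contMDiffOn_snd fun z hz => hz.2)
  have h2 := hF.smooth.comp h1 fun z hz => ⟨hz.1, mem_univ _⟩
  rw [← modelWithCornersSelf_prod, chartedSpaceSelf_prod] at h2
  exact h2.contDiffOn

theorem contDiffAt_flowParam (hF : IsMeanCurvatureFlow t₀ t₁ F) {p : N} {t : ℝ}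
    {u : EuclideanSpace ℝ (Fin n)} (ht : t ∈ Ioo t₀ t₁) (hu : u ∈ (extChartAt (𝓡 n) p).target) :
    ContDiffAt ℝ ∞ (flowParam F p) (t, u) :=
  (contDiffOn_flowParam hF p).contDiffAt
    (prod_mem_nhds (Ico_mem_nhds ht.1 ht.2) ((isOpen_extChartAt_target p).mem_nhds hu))

/-- Includes the initial time, where only derivatives within the half-open interval are available.
It provides continuity of the area density up to `t₀`. -/
theorem fderiv_localParam_eq_fderivWithin (hF : IsMeanCurvatureFlow t₀ t₁ F) {p : N} {t : ℝ}
    {u : EuclideanSpace ℝ (Fin n)} (ht : t ∈ Ico t₀ t₁) (hu : u ∈ (extChartAt (𝓡 n) p).target) :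
    fderiv ℝ (localParam (F t) p) u =
      (fderivWithin ℝ (flowParam F p) (Ico t₀ t₁ ×ˢ (extChartAt (𝓡 n) p).target) (t, u)).comp
        (ContinuousLinearMap.inr ℝ ℝ _) := by
  have h1 : HasFDerivWithinAt (flowParam F p)
      (fderivWithin ℝ (flowParam F p) (Ico t₀ t₁ ×ˢ (extChartAt (𝓡 n) p).target) (t, u))
      (Ico t₀ t₁ ×ˢ (extChartAt (𝓡 n) p).target) (t, u) :=
    ((contDiffOn_flowParam hF p).differentiableOn (by simp) (t, u) ⟨ht, hu⟩).hasFDerivWithinAt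
  have h2 := h1.comp u (hasFDerivAt_prodMk_right t u).hasFDerivWithinAt
    (s := (extChartAt (𝓡 n) p).target) fun y hy => ⟨ht, hy⟩
  exact (h2.hasFDerivAt ((isOpen_extChartAt_target p).mem_nhds hu)).fderiv

theorem fderiv_localParam_apply (hF : IsMeanCurvatureFlow t₀ t₁ F) {p : N} {t : ℝ}
    {u : EuclideanSpace ℝ (Fin n)} (ht : t ∈ Ioo t₀ t₁) (hu : u ∈ (extChartAt (𝓡 n) p).target)
    (v : EuclideanSpace ℝ (Fin n)) :
    fderiv ℝ (localParam (F t) p) u v = fderiv ℝ (flowParam F p) (t, u) (0, v) := by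
  rw [fderiv_localParam_eq_fderivWithin hF (Ioo_subset_Ico_self ht) hu,
    fderivWithin_of_mem_nhds
      (prod_mem_nhds (Ico_mem_nhds ht.1 ht.2) ((isOpen_extChartAt_target p).mem_nhds hu))]
  simp

theorem fderiv_fderiv_localParam_apply (hF : IsMeanCurvatureFlow t₀ t₁ F) {p : N} {t : ℝ}
    {u : EuclideanSpace ℝ (Fin n)} (ht : t ∈ Ioo t₀ t₁) (hu : u ∈ (extChartAt (𝓡 n) p).target)
    (v w : EuclideanSpace ℝ (Fin n)) :
    fderiv ℝ (fderiv ℝ (localParam (F t) p)) u v w =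
      fderiv ℝ (fun y => fderiv ℝ (flowParam F p) y (0, w)) (t, u) (0, v) := by
  have hsm := (hF.hypersurface t (Ioo_subset_Ico_self ht)).smooth
  rw [← fderiv_fderiv_apply (h := localParam (F t) p) (contDiffAt_comp_extChartAt_symm hsm p hu)]
  have hev : (fun y => fderiv ℝ (localParam (F t) p) y w) =ᶠ[𝓝 u]
      (fun y => fderiv ℝ (flowParam F p) y (0, w)) ∘ Prod.mk t := by
    filter_upwards [(isOpen_extChartAt_target p).mem_nhds hu] with y hy
    exact fderiv_localParam_apply hF ht hy w
  have hd : DifferentiableAt ℝ (fun y => fderiv ℝ (flowParam F p) y (0, w)) (t, u) :=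
    (contDiffAt_fderiv_apply (contDiffAt_flowParam hF ht hu) _).differentiableAt (by simp)
  rw [hev.fderiv_eq, (hd.hasFDerivAt.comp u (hasFDerivAt_prodMk_right t u)).fderiv]
  simp

theorem gramAt_flowParam (hF : IsMeanCurvatureFlow t₀ t₁ F) {p : N} {t : ℝ}
    {u : EuclideanSpace ℝ (Fin n)} (ht : t ∈ Ioo t₀ t₁) (hu : u ∈ (extChartAt (𝓡 n) p).target) :
    gramAt (flowParam F p) (spaceVec n) (t, u) =
      Matrix.gram ℝ fun i => fderiv ℝ (localParam (F t) p) u (EuclideanSpace.single i 1) := by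
  simp_rw [fderiv_localParam_apply hF ht hu]
  rfl

theorem det_gramAt_flowParam_pos (hF : IsMeanCurvatureFlow t₀ t₁ F) {p : N} {t : ℝ}
    {u : EuclideanSpace ℝ (Fin n)} (ht : t ∈ Ioo t₀ t₁) (hu : u ∈ (extChartAt (𝓡 n) p).target) :
    0 < (gramAt (flowParam F p) (spaceVec n) (t, u)).det := by
  rw [gramAt_flowParam hF ht hu]
  simpa using det_gram_pos (injective_fderiv_localParam
    (hF.hypersurface t (Ioo_subset_Ico_self ht)) hu) (EuclideanSpace.basisFun (Fin n) ℝ)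

/-- Links the density differentiated in space-time with the Jacobian of the area formula on each
time slice. -/
theorem volDensity_flowParam (hF : IsMeanCurvatureFlow t₀ t₁ F) {p : N} {t : ℝ}
    {u : EuclideanSpace ℝ (Fin n)} (ht : t ∈ Ioo t₀ t₁) (hu : u ∈ (extChartAt (𝓡 n) p).target) :
    volDensity (flowParam F p) (spaceVec n) (t, u) =
      (fderiv ℝ (localParam (F t) p) u : EuclideanSpace ℝ (Fin n) →ₗ[ℝ] Ambient n).normDet := by
  rw [volDensity, gramAt_flowParam hF ht hu,
    normDet_eq_sqrt_det_gram _ (EuclideanSpace.basisFun (Fin n) ℝ)]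
  simp

/-- The velocity of a mean curvature flow in terms of a unit normal. -/
theorem fderiv_flowParam_timeVec (hF : IsMeanCurvatureFlow t₀ t₁ F) {p : N} {t : ℝ}
    {u : EuclideanSpace ℝ (Fin n)} (ht : t ∈ Ioo t₀ t₁) (hu : u ∈ (extChartAt (𝓡 n) p).target)
    {ν : Ambient n} (hν : IsUnitNormal (F t) ((extChartAt (𝓡 n) p).symm u) ν) :
    fderiv ℝ (flowParam F p) (t, u) (timeVec n) =
      -(meanCurvature (F t) ((extChartAt (𝓡 n) p).symm u) ν) • ν := by
  have h1 := (hF.equation t (Ioo_subset_Ico_self ht) _ ν hν).hasDerivAt (Ico_mem_nhds ht.1 ht.2)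
  have h2 : HasDerivAt (fun s => flowParam F p (s, u))
      (fderiv ℝ (flowParam F p) (t, u) (timeVec n)) t :=
    HasFDerivAt.comp_hasDerivAt (l := flowParam F p) (f := fun s => (s, u)) t
      ((contDiffAt_flowParam hF ht hu).differentiableAt (by simp)).hasFDerivAt
      ((hasDerivAt_id t).prodMk (hasDerivAt_const t u))
  exact h2.unique h1

theorem inner_fderiv_flowParam_timeVec (hF : IsMeanCurvatureFlow t₀ t₁ F) {p : N} {t : ℝ}
    {u : EuclideanSpace ℝ (Fin n)} (ht : t ∈ Ioo t₀ t₁) (hu : u ∈ (extChartAt (𝓡 n) p).target)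
    (i : Fin n) : inner ℝ (fderiv ℝ (flowParam F p) (t, u) (timeVec n))
      (fderiv ℝ (flowParam F p) (t, u) (spaceVec n i)) = 0 := by
  have hsm := (hF.hypersurface t (Ioo_subset_Ico_self ht)).smooth
  obtain ⟨ν, hν⟩ := exists_isUnitNormal hsm hu
  rw [fderiv_flowParam_timeVec hF ht hu hν, inner_smul_left, spaceVec,
    ← fderiv_localParam_apply hF ht hu, ((isUnitNormal_iff hsm hu).1 hν).2 i, mul_zero]

/-- The velocity of a mean curvature flow is the mean curvature vector, in any chart. -/
theorem inner_fderiv_flowParam_timeVec_normal (hF : IsMeanCurvatureFlow t₀ t₁ F) {p : N} {t : ℝ}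
    {u : EuclideanSpace ℝ (Fin n)} (ht : t ∈ Ioo t₀ t₁) (hu : u ∈ (extChartAt (𝓡 n) p).target)
    (ν : Ambient n)
    (hν : ∀ i, inner ℝ ν (fderiv ℝ (flowParam F p) (t, u) (spaceVec n i)) = 0) :
    inner ℝ (fderiv ℝ (flowParam F p) (t, u) (timeVec n)) ν =
      ∑ i, ∑ j, (gramAt (flowParam F p) (spaceVec n) (t, u))⁻¹ i j *
        inner ℝ (fderiv ℝ (fun y => fderiv ℝ (flowParam F p) y (spaceVec n j)) (t, u)
          (spaceVec n i)) ν := by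
  rcases eq_or_ne ν 0 with rfl | hν0
  · simp
  have hhyp := hF.hypersurface t (Ioo_subset_Ico_self ht)
  have hn0 : ‖ν‖ ≠ 0 := norm_ne_zero_iff.2 hν0
  -- The flow equation speaks of unit normals only. Both sides are linear in `ν`, so the unit case
  -- suffices.
  set ν' := ‖ν‖⁻¹ • ν with hν'
  have hunit : IsUnitNormal (F t) ((extChartAt (𝓡 n) p).symm u) ν' := by
    refine (isUnitNormal_iff hhyp.smooth hu).2 ⟨?_, fun i => ?_⟩
    · rw [hν', norm_smul, norm_inv, norm_norm, inv_mul_cancel₀ hn0]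
    · have := hν i
      rw [spaceVec, ← fderiv_localParam_apply hF ht hu] at this
      rw [hν', inner_smul_left, this, mul_zero]
  have hνν : ν = ‖ν‖ • ν' := by rw [hν', smul_smul, mul_inv_cancel₀ hn0, one_smul]
  have h1 : inner ℝ (fderiv ℝ (flowParam F p) (t, u) (timeVec n)) ν' =
      -(meanCurvature (F t) ((extChartAt (𝓡 n) p).symm u) ν') := by
    rw [fderiv_flowParam_timeVec hF ht hu hunit, inner_smul_left, real_inner_self_eq_norm_sq,
      hunit.1]
    simp
  rw [meanCurvature_eq_of_mem_target hhyp hu hunit, neg_neg, ← gramAt_flowParam hF ht hu] at h1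
  clear_value ν'
  rw [hνν, inner_smul_right, h1, Finset.mul_sum]
  refine Finset.sum_congr rfl fun i _ => ?_
  rw [Finset.mul_sum]
  refine Finset.sum_congr rfl fun j _ => ?_
  rw [fderiv_fderiv_localParam_apply hF ht hu, inner_smul_right]
  simp only [spaceVec]
  ring

/-- The time remaining until `s`. -/
def timeLeft (n : ℕ) (s : ℝ) (z : ℝ × EuclideanSpace ℝ (Fin n)) : ℝ := s - z.1

theorem contDiff_timeLeft (n : ℕ) (s : ℝ) : ContDiff ℝ ∞ (timeLeft n s) :=
  contDiff_const.sub contDiff_fst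

theorem fderiv_timeLeft (s : ℝ) (z v : ℝ × EuclideanSpace ℝ (Fin n)) :
    fderiv ℝ (timeLeft n s) z v = -v.1 := by
  have : HasFDerivAt (timeLeft n s) (-(ContinuousLinearMap.fst ℝ ℝ (EuclideanSpace ℝ (Fin n)))) z :=
    hasFDerivAt_fst.const_sub s
  rw [this.fderiv]
  simp

/-- Pointwise monotonicity along a mean curvature flow in a chart. -/
theorem fderiv_heatDensity_flowParam_le (hF : IsMeanCurvatureFlow t₀ t₁ F) {p : N} {t : ℝ}
    {u : EuclideanSpace ℝ (Fin n)} (ht : t ∈ Ioo t₀ t₁) (hu : u ∈ (extChartAt (𝓡 n) p).target)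
    (x₀ : Ambient n) {s : ℝ} (hs : t < s) :
    fderiv ℝ (fun y => heatDensity n (timeLeft n s) x₀ (flowParam F p) y *
        volDensity (flowParam F p) (spaceVec n) y) (t, u) (timeVec n) +
      ∑ i, fderiv ℝ (heatFlux n (timeLeft n s) x₀ (flowParam F p) (spaceVec n) i) (t, u)
        (spaceVec n i) ≤ 0 := by
  have := fderiv_heatDensity_mul_volDensity_add_le (τ := timeLeft n s) (e₀ := timeVec n) x₀
    (contDiffAt_flowParam hF ht hu) (det_gramAt_flowParam_pos hF ht hu)
    (contDiff_timeLeft n s).contDiffAt (sub_pos.2 hs) (by simp [fderiv_timeLeft, timeVec])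
    (fun i => by simp [fderiv_timeLeft, spaceVec])
    (by
      filter_upwards [prod_mem_nhds (Ioo_mem_nhds ht.1 ht.2)
        ((isOpen_extChartAt_target p).mem_nhds hu)] with y hy
      exact fun i => inner_fderiv_flowParam_timeVec hF hy.1 hy.2 i)
    (fun ν hν => inner_fderiv_flowParam_timeVec_normal hF ht hu ν hν)
  simpa only [Fintype.card_fin] using this

end Flow

end MCF

end

noncomputable section

namespace MCF

/-! ### The Hausdorff area measure pulled back to the parametrizing manifold. -/

section HypersurfaceMeasure

open Set MeasureTheory

variable {n : ℕ} {N : Type*} [TopologicalSpace N] [ChartedSpace (EuclideanSpace ℝ (Fin n)) N]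

/-- The area density of a hypersurface in the chart at `p`. -/
def areaDensity (f : N → Ambient n) (p : N) (u : EuclideanSpace ℝ (Fin n)) : ℝ :=
  (fderiv ℝ (localParam f p) u : EuclideanSpace ℝ (Fin n) →ₗ[ℝ] Ambient n).normDet

theorem areaDensity_nonneg (f : N → Ambient n) (p : N) (u : EuclideanSpace ℝ (Fin n)) :
    0 ≤ areaDensity f p u := LinearMap.normDet_nonneg _

theorem continuousOn_areaDensity [IsManifold (𝓡 n) ∞ N] {f : N → Ambient n}
    (hf : IsEmbeddedHypersurface f) (p : N) :
    ContinuousOn (areaDensity f p) (extChartAt (𝓡 n) p).target :=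
  continuous_normDet.comp_continuousOn ((contDiffOn_comp_extChartAt_symm hf.smooth p
    ).continuousOn_fderiv_of_isOpen (isOpen_extChartAt_target p) (by simp))

theorem measurable_toNNReal_areaDensity [IsManifold (𝓡 n) ∞ N] {f : N → Ambient n}
    (hf : IsEmbeddedHypersurface f) (p : N) :
    Measurable fun u : (extChartAt (𝓡 n) p).target => (areaDensity f p u).toNNReal :=
  (continuous_real_toNNReal.comp
    (continuousOn_iff_continuous_domRestrict.1 (continuousOn_areaDensity hf p))).measurable

/-- The inverse of the chart at `p`, on its domain. -/
def chartInv (n : ℕ) {N : Type*} [TopologicalSpace N]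
    [ChartedSpace (EuclideanSpace ℝ (Fin n)) N] (p : N) (u : (extChartAt (𝓡 n) p).target) : N :=
  (extChartAt (𝓡 n) p).symm u

variable [MeasurableSpace N]

/-- The area measure of a hypersurface, on its domain of parametrization. -/
def hypMeasure (f : N → Ambient n) : Measure N := Measure.comap f μHE[n]

variable [BorelSpace N] {f : N → Ambient n}

theorem measurableEmbedding_of_hypersurface [CompactSpace N] (hf : IsEmbeddedHypersurface f) :
    MeasurableEmbedding f :=
  (hf.embedding.continuous.isClosedEmbedding hf.embedding.injective).measurableEmbedding

theorem lintegral_areaMeasure_range [CompactSpace N] (hf : IsEmbeddedHypersurface f)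
    (g : Ambient n → ℝ≥0∞) :
    ∫⁻ x, g x ∂(areaMeasure n 1 (range f)) = ∫⁻ q, g (f q) ∂(hypMeasure f) := by
  have hme := measurableEmbedding_of_hypersurface hf
  rw [areaMeasure, Nat.cast_one, one_smul, ← hme.map_comap, hme.lintegral_map]
  rfl

theorem measurableEmbedding_chartInv (p : N) : MeasurableEmbedding (chartInv n p) := by
  refine Topology.IsOpenEmbedding.measurableEmbedding ?_
  have h := (chartAt (EuclideanSpace ℝ (Fin n)) p).symm.isOpenEmbedding_restrict
  have e : (extChartAt (𝓡 n) p).target = (chartAt (EuclideanSpace ℝ (Fin n)) p).target := by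
    simp
  let j : (extChartAt (𝓡 n) p).target ≃ₜ (chartAt (EuclideanSpace ℝ (Fin n)) p).target :=
    Homeomorph.setCongr e
  exact h.comp j.isOpenEmbedding

variable [IsManifold (𝓡 n) ∞ N]

/-- The area formula for the local parametrization, which is an injective immersion of the open
chart target. -/
theorem hypMeasure_restrict_source [CompactSpace N] (hf : IsEmbeddedHypersurface f) (p : N) :
    (hypMeasure f).restrict (extChartAt (𝓡 n) p).source =
      Measure.map (chartInv n p) ((Measure.comap Subtype.val volume).withDensity
        fun u => ((areaDensity f p u).toNNReal : ℝ≥0∞)) := by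
  have hopen : IsOpen (extChartAt (𝓡 n) p).target := isOpen_extChartAt_target p
  have hme := measurableEmbedding_chartInv (n := n) p
  ext B hB
  have hpre : MeasurableSet (chartInv n p ⁻¹' B) := hme.measurable hB
  rw [Measure.restrict_apply hB, Measure.map_apply hme.measurable hB, withDensity_apply _ hpre,
    hypMeasure, (measurableEmbedding_of_hypersurface hf).comap_apply]
  have himg : f '' (B ∩ (extChartAt (𝓡 n) p).source) =
      localParam f p '' (Subtype.val '' (chartInv n p ⁻¹' B)) := by
    ext x
    constructor
    · rintro ⟨q, ⟨hqB, hq⟩, rfl⟩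
      have hl := (extChartAt (𝓡 n) p).left_inv hq
      refine ⟨extChartAt (𝓡 n) p q, ⟨⟨_, (extChartAt (𝓡 n) p).map_source hq⟩, ?_, rfl⟩, ?_⟩
      · change (extChartAt (𝓡 n) p).symm (extChartAt (𝓡 n) p q) ∈ B
        rwa [hl]
      · simp only [localParam, Function.comp_apply, hl]
    · rintro ⟨_, ⟨u, hu, rfl⟩, rfl⟩
      exact ⟨_, ⟨hu, (extChartAt (𝓡 n) p).map_target u.2⟩, rfl⟩
  have hcd := contDiffOn_comp_extChartAt_symm hf.smooth p
  have harea := euclideanHausdorffMeasure_image_eq_lintegral (f := localParam f p)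
    (f' := fderiv ℝ (localParam f p)) hopen
    (fun u hu => (hcd.contDiffAt (hopen.mem_nhds hu)).hasStrictFDerivAt (by simp))
    (hcd.continuousOn_fderiv_of_isOpen hopen (by simp))
    (fun u hu => injective_fderiv_localParam hf hu)
    (hf.embedding.injective.comp_injOn (extChartAt (𝓡 n) p).symm.injOn)
    ((MeasurableEmbedding.subtype_coe hopen.measurableSet).measurableSet_image.2 hpre)
    (by rintro _ ⟨u, _, rfl⟩; exact u.2)
  rw [finrank_euclideanSpace_fin] at harea
  rw [himg, harea, ← setLIntegral_subtype hopen.measurableSet]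
  rfl

/-- Integrals over a hypersurface of functions supported in one chart. -/
theorem integral_hypMeasure_eq [CompactSpace N] (hf : IsEmbeddedHypersurface f) (p : N)
    {w : N → ℝ} (hw : ∀ q ∉ (extChartAt (𝓡 n) p).source, w q = 0) :
    ∫ q, w q ∂(hypMeasure f) = ∫ u in (extChartAt (𝓡 n) p).target,
      areaDensity f p u * w ((extChartAt (𝓡 n) p).symm u) := by
  have hopen : IsOpen (extChartAt (𝓡 n) p).target := isOpen_extChartAt_target p
  rw [← setIntegral_eq_integral_of_forall_compl_eq_zero hw, hypMeasure_restrict_source hf,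
    (measurableEmbedding_chartInv p).integral_map,
    integral_withDensity_eq_integral_smul (measurable_toNNReal_areaDensity hf p),
    ← integral_subtype_comap hopen.measurableSet]
  refine integral_congr_ae (Filter.Eventually.of_forall fun u => ?_)
  simp [NNReal.smul_def, chartInv, areaDensity_nonneg]

theorem integrable_hypMeasure_iff [CompactSpace N] (hf : IsEmbeddedHypersurface f) (p : N)
    {w : N → ℝ} (hw : ∀ q ∉ (extChartAt (𝓡 n) p).source, w q = 0) :
    Integrable w (hypMeasure f) ↔ IntegrableOn (fun u =>
      areaDensity f p u * w ((extChartAt (𝓡 n) p).symm u)) (extChartAt (𝓡 n) p).target := by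
  have hopen : IsOpen (extChartAt (𝓡 n) p).target := isOpen_extChartAt_target p
  rw [← integrableOn_iff_integrable_of_support_subset (s := (extChartAt (𝓡 n) p).source)
      (fun q hq => by by_contra h; exact hq (hw q h)), IntegrableOn,
    hypMeasure_restrict_source hf, (measurableEmbedding_chartInv p).integrable_map_iff,
    integrable_withDensity_iff_integrable_smul (measurable_toNNReal_areaDensity hf p),
    integrableOn_iff_comap_subtypeVal hopen.measurableSet]
  refine integrable_congr (Filter.Eventually.of_forall fun u => ?_)
  simp only [NNReal.smul_def, Real.coe_toNNReal _ (areaDensity_nonneg f p u), smul_eq_mul]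
  rfl

/-- By compactness it is enough to be finite near each point, where the area is bounded by the
integral of a continuous density over a closed ball in the chart. -/
theorem isFiniteMeasure_hypMeasure [CompactSpace N] (hf : IsEmbeddedHypersurface f) :
    IsFiniteMeasure (hypMeasure f) := by
  refine ⟨isCompact_univ.measure_lt_top_of_nhdsWithin fun p _ => ?_⟩
  rw [nhdsWithin_univ]
  have hopen : IsOpen (extChartAt (𝓡 n) p).target := isOpen_extChartAt_target p
  obtain ⟨r, hr, hball⟩ := Metric.nhds_basis_closedBall.mem_iff.1
    (hopen.mem_nhds (mem_extChartAt_target p))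
  set K := Metric.closedBall (extChartAt (𝓡 n) p p) r
  have hO : IsOpen ((extChartAt (𝓡 n) p).source ∩
      extChartAt (𝓡 n) p ⁻¹' Metric.ball (extChartAt (𝓡 n) p p) r) :=
    (continuousOn_extChartAt p).isOpen_inter_preimage (isOpen_extChartAt_source p)
      Metric.isOpen_ball
  refine ⟨_, hO.mem_nhds ⟨mem_extChartAt_source p, Metric.mem_ball_self hr⟩, ?_⟩
  have hme := measurableEmbedding_chartInv (n := n) p
  rw [← inter_eq_self_of_subset_left (inter_subset_left (s := (extChartAt (𝓡 n) p).source)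
      (t := extChartAt (𝓡 n) p ⁻¹' Metric.ball (extChartAt (𝓡 n) p p) r)),
    ← Measure.restrict_apply hO.measurableSet, hypMeasure_restrict_source hf,
    Measure.map_apply hme.measurable hO.measurableSet,
    withDensity_apply _ (hme.measurable hO.measurableSet),
    setLIntegral_subtype hopen.measurableSet _
      (fun u => ((areaDensity f p u).toNNReal : ℝ≥0∞))]
  refine lt_of_le_of_lt (lintegral_mono_set (t := K) ?_)
    (IntegrableOn.setLIntegral_lt_top (((continuousOn_areaDensity hf p).mono
      hball).integrableOn_compact (isCompact_closedBall _ _)))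
  rintro _ ⟨u, hu, rfl⟩
  have : extChartAt (𝓡 n) p (chartInv n p u) = u := (extChartAt (𝓡 n) p).right_inv u.2
  have h2 : extChartAt (𝓡 n) p (chartInv n p u) ∈ Metric.ball (extChartAt (𝓡 n) p p) r := hu.2
  rw [this] at h2
  exact Metric.ball_subset_closedBall h2

end HypersurfaceMeasure

end MCF

end

noncomputable section

namespace MCF

/-! ### Integration against compactly supported cutoffs. -/

section Cutoff

open Set MeasureTheory Filter

/-- Nothing is known about `Q` outside `U`, but the closed support of `χ` lies in `U`, so the
product vanishes near every other point. -/
theorem continuousOn_cutoff_mul {X E : Type*} [TopologicalSpace X] [TopologicalSpace E] {χ : E → ℝ}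
    {U : Set E} {Q : X × E → ℝ} {s : Set X} (hχ : Continuous χ) (hsupp : tsupport χ ⊆ U)
    (hU : IsOpen U) (hQ : ContinuousOn Q (s ×ˢ U)) :
    ContinuousOn (fun z : X × E => χ z.2 * Q z) (s ×ˢ univ) := by
  rintro ⟨x, u⟩ ⟨hx, -⟩
  by_cases hu : u ∈ U
  · have h1 : ContinuousWithinAt Q (s ×ˢ univ) (x, u) := by
      refine (hQ (x, u) ⟨hx, hu⟩).mono_of_mem_nhdsWithin ?_
      rw [nhdsWithin_prod_eq]
      exact prod_mem_prod self_mem_nhdsWithin (mem_nhdsWithin_of_mem_nhds (hU.mem_nhds hu))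
    exact (hχ.comp continuous_snd).continuousWithinAt.mul h1
  · have hev : (fun z : X × E => χ z.2 * Q z) =ᶠ[𝓝 (x, u)] fun _ => 0 := by
      have : ∀ᶠ y in 𝓝 u, y ∉ tsupport χ :=
        (isClosed_tsupport χ).isOpen_compl.mem_nhds fun h => hu (hsupp h)
      filter_upwards [continuous_snd.continuousAt.eventually this] with z hz
      rw [image_eq_zero_of_notMem_tsupport hz, zero_mul]
    exact (continuousAt_const.congr hev.symm).continuousWithinAt

theorem continuous_cutoff_mul {E : Type*} [TopologicalSpace E] {χ : E → ℝ} {U : Set E} {Q : E → ℝ}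
    (hχ : Continuous χ) (hsupp : tsupport χ ⊆ U) (hU : IsOpen U) (hQ : ContinuousOn Q U) :
    Continuous fun u => χ u * Q u := by
  have h := continuousOn_cutoff_mul (X := Unit) (s := univ) (Q := fun z => Q z.2) hχ hsupp hU
    (hQ.comp continuousOn_snd fun z hz => hz.2)
  exact (h.comp_continuous (f := fun u => ((), u)) (by fun_prop) fun u => ⟨mem_univ _, mem_univ _⟩)

variable {E : Type*} [NormedAddCommGroup E] [MeasurableSpace E] [BorelSpace E] {μ : Measure E}

theorem integrable_cutoff_mul [IsFiniteMeasureOnCompacts μ] {χ : E → ℝ} {U : Set E} {Q : E → ℝ}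
    (hχ : Continuous χ) (hc : HasCompactSupport χ) (hsupp : tsupport χ ⊆ U) (hU : IsOpen U)
    (hQ : ContinuousOn Q U) : Integrable (fun u => χ u * Q u) μ :=
  (continuous_cutoff_mul hχ hsupp hU hQ).integrable_of_hasCompactSupport hc.mul_right

variable [NormedSpace ℝ E]

theorem hasDerivAt_integral_cutoff_mul [IsFiniteMeasureOnCompacts μ] {χ : E → ℝ} {U : Set E}
    {Q : ℝ × E → ℝ} {a b t : ℝ} (ht : t ∈ Ioo a b) (hχ : Continuous χ) (hc : HasCompactSupport χ)
    (hsupp : tsupport χ ⊆ U) (hU : IsOpen U) (hQ : ContDiffOn ℝ ∞ Q (Ioo a b ×ˢ U)) :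
    HasDerivAt (fun t => ∫ u, χ u * Q (t, u) ∂μ) (∫ u, χ u * fderiv ℝ Q (t, u) (1, 0) ∂μ) t := by
  have hO : IsOpen (Ioo a b ×ˢ U) := isOpen_Ioo.prod hU
  have hQc : ∀ r ∈ Ioo a b, ContinuousOn (fun u => Q (r, u)) U := fun r hr =>
    hQ.continuousOn.comp (by fun_prop) fun u hu => ⟨hr, hu⟩
  have hDc : ContinuousOn (fun z => fderiv ℝ Q z (1, 0)) (Ioo a b ×ˢ U) :=
    (hQ.continuousOn_fderiv_of_isOpen hO (by simp)).clm_apply continuousOn_const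
  obtain ⟨ε, hε, hball⟩ := Metric.nhds_basis_closedBall.mem_iff.1 (Ioo_mem_nhds ht.1 ht.2)
  have hcomp : IsCompact (Metric.closedBall t ε ×ˢ tsupport χ) :=
    (isCompact_closedBall t ε).prod hc
  -- The derivative of the integrand is bounded on the compact product of a time interval and the
  -- support of `χ`; `C` times the indicator of that support is the dominating function.
  obtain ⟨C, hC⟩ := hcomp.exists_bound_of_continuousOn
    (((hχ.comp continuous_snd).continuousOn).mul
      (hDc.mono (prod_mono hball hsupp)))
  refine (hasDerivAt_integral_of_dominated_loc_of_deriv_le (s := Metric.closedBall t ε)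
    (bound := (tsupport χ).indicator fun _ => C)
    (F' := fun r u => χ u * fderiv ℝ Q (r, u) (1, 0))
    (Metric.closedBall_mem_nhds t hε) ?_ (integrable_cutoff_mul hχ hc hsupp hU (hQc t ht)) ?_ ?_
    ?_ ?_).2
  · filter_upwards [Ioo_mem_nhds ht.1 ht.2] with r hr
    exact (continuous_cutoff_mul hχ hsupp hU (hQc r hr)).aestronglyMeasurable
  · exact (continuous_cutoff_mul hχ hsupp hU
      (hDc.comp (by fun_prop) fun u hu => ⟨ht, hu⟩)).aestronglyMeasurable
  · refine Eventually.of_forall fun u r hr => ?_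
    by_cases hu : u ∈ tsupport χ
    · rw [indicator_of_mem hu]
      exact hC (r, u) ⟨hr, hu⟩
    · rw [indicator_of_notMem hu, image_eq_zero_of_notMem_tsupport hu]
      simp
  · exact (integrable_indicator_iff (isClosed_tsupport χ).measurableSet).2
      (integrableOn_const hc.measure_lt_top.ne)
  · refine Eventually.of_forall fun u r hr => ?_
    by_cases hu : u ∈ tsupport χ
    · have hd : DifferentiableAt ℝ Q (r, u) :=
        (hQ.contDiffAt (hO.mem_nhds ⟨hball hr, hsupp hu⟩)).differentiableAt (by simp)
      exact (HasFDerivAt.comp_hasDerivAt (l := Q) (f := fun r => (r, u)) r hd.hasFDerivAt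
        ((hasDerivAt_id r).prodMk (hasDerivAt_const r u))).const_mul (χ u)
    · simp only [image_eq_zero_of_notMem_tsupport hu, zero_mul]
      exact hasDerivAt_const r 0

/-- Integration by parts without boundary terms, since `χ` has compact support inside the region
where `K` is smooth. -/
theorem integral_cutoff_mul_fderiv [FiniteDimensional ℝ E] [μ.IsAddHaarMeasure] {χ K : E → ℝ} {U : Set E}
    (hχ : ContDiff ℝ ∞ χ) (hc : HasCompactSupport χ) (hsupp : tsupport χ ⊆ U) (hU : IsOpen U)
    (hK : ContDiffOn ℝ ∞ K U) (v : E) :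
    ∫ u, χ u * fderiv ℝ K u v ∂μ = -∫ u, fderiv ℝ χ u v * K u ∂μ := by
  have hd : Continuous fun u => fderiv ℝ χ u v :=
    (hχ.continuous_fderiv (by simp)).clm_apply continuous_const
  have hds : tsupport (fun u => fderiv ℝ χ u v) ⊆ tsupport χ :=
    tsupport_fderiv_apply_subset ℝ v
  refine integral_mul_fderiv_eq_neg_fderiv_mul_of_integrable ?_ ?_ ?_ ?_ ?_
  · exact integrable_cutoff_mul hd (hc.fderiv_apply ℝ v) (hds.trans hsupp) hU hK.continuousOn
  · exact integrable_cutoff_mul hχ.continuous hc hsupp hU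
      ((hK.continuousOn_fderiv_of_isOpen hU (by simp)).clm_apply continuousOn_const)
  · exact integrable_cutoff_mul hχ.continuous hc hsupp hU hK.continuousOn
  · exact fun x _ => hχ.differentiable (by simp) x
  · exact fun x hx => (hK.contDiffAt (hU.mem_nhds (hsupp hx))).differentiableAt (by simp)

end Cutoff

/-! ### Cutoff functions in charts and finite partitions of unity. -/

section ChartCutoff

open Set MeasureTheory Filter

variable {n : ℕ} {N : Type*} [TopologicalSpace N] [ChartedSpace (EuclideanSpace ℝ (Fin n)) N]

/-- A function supported in the chart at `p`, written in this chart. -/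
def chartCutoff (χ : N → ℝ) (p : N) : EuclideanSpace ℝ (Fin n) → ℝ :=
  (extChartAt (𝓡 n) p).target.indicator (χ ∘ (extChartAt (𝓡 n) p).symm)

theorem chartCutoff_of_mem (χ : N → ℝ) {p : N} {u : EuclideanSpace ℝ (Fin n)}
    (hu : u ∈ (extChartAt (𝓡 n) p).target) :
    chartCutoff χ p u = χ ((extChartAt (𝓡 n) p).symm u) := indicator_of_mem hu _

theorem chartCutoff_eventuallyEq (χ : N → ℝ) {p : N} {u : EuclideanSpace ℝ (Fin n)}
    (hu : u ∈ (extChartAt (𝓡 n) p).target) :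
    chartCutoff χ p =ᶠ[𝓝 u] χ ∘ (extChartAt (𝓡 n) p).symm := by
  filter_upwards [(isOpen_extChartAt_target p).mem_nhds hu] with y hy
  exact chartCutoff_of_mem χ hy

variable [CompactSpace N] {χ : N → ℝ} {p : N}

theorem isCompact_image_tsupport (hs : tsupport χ ⊆ (extChartAt (𝓡 n) p).source) :
    IsCompact (extChartAt (𝓡 n) p '' tsupport χ) :=
  (isClosed_tsupport χ).isCompact.image_of_continuousOn ((continuousOn_extChartAt p).mono hs)

theorem tsupport_chartCutoff_subset_image (hs : tsupport χ ⊆ (extChartAt (𝓡 n) p).source) :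
    tsupport (chartCutoff χ p : EuclideanSpace ℝ (Fin n) → ℝ) ⊆
      extChartAt (𝓡 n) p '' tsupport χ := by
  refine closure_minimal (fun u hu => ?_) (isCompact_image_tsupport hs).isClosed
  have hut : u ∈ (extChartAt (𝓡 n) p).target := by
    by_contra h; exact hu (indicator_of_notMem h _)
  rw [Function.mem_support, chartCutoff_of_mem χ hut] at hu
  exact ⟨_, subset_tsupport χ hu, (extChartAt (𝓡 n) p).right_inv hut⟩

theorem tsupport_chartCutoff_subset (hs : tsupport χ ⊆ (extChartAt (𝓡 n) p).source) :
    tsupport (chartCutoff χ p) ⊆ (extChartAt (𝓡 n) p).target := by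
  refine (tsupport_chartCutoff_subset_image hs).trans ?_
  rintro _ ⟨q, hq, rfl⟩
  exact (extChartAt (𝓡 n) p).map_source (hs hq)

theorem hasCompactSupport_chartCutoff (hs : tsupport χ ⊆ (extChartAt (𝓡 n) p).source) :
    HasCompactSupport (chartCutoff χ p : EuclideanSpace ℝ (Fin n) → ℝ) :=
  (isCompact_image_tsupport hs).of_isClosed_subset (isClosed_tsupport _)
    (tsupport_chartCutoff_subset_image hs)

variable [IsManifold (𝓡 n) ∞ N]

theorem contDiff_chartCutoff (hχ : ContMDiff (𝓡 n) 𝓘(ℝ, ℝ) ∞ χ)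
    (hs : tsupport χ ⊆ (extChartAt (𝓡 n) p).source) :
    ContDiff ℝ ∞ (chartCutoff χ p : EuclideanSpace ℝ (Fin n) → ℝ) := by
  refine contDiff_iff_contDiffAt.2 fun u => ?_
  by_cases hu : u ∈ (extChartAt (𝓡 n) p).target
  · exact (contDiffAt_comp_extChartAt_symm hχ p hu).congr_of_eventuallyEq
      (chartCutoff_eventuallyEq χ hu)
  · refine (contDiffAt_const (c := (0 : ℝ))).congr_of_eventuallyEq ?_
    filter_upwards [(isClosed_tsupport (chartCutoff χ p)).isOpen_compl.mem_nhds
      fun h => hu (tsupport_chartCutoff_subset hs h)] with y hy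
    exact image_eq_zero_of_notMem_tsupport hy

/-- A finite smooth partition of unity subordinate to charts. -/
theorem exists_finite_partition (n : ℕ) (N : Type*) [TopologicalSpace N]
    [ChartedSpace (EuclideanSpace ℝ (Fin n)) N] [CompactSpace N] [IsManifold (𝓡 n) ∞ N]
    [T2Space N] : ∃ (s : Finset N) (χ : s → N → ℝ),
      (∀ k, ContMDiff (𝓡 n) 𝓘(ℝ, ℝ) ∞ (χ k)) ∧ (∀ k q, 0 ≤ χ k q) ∧
      (∀ k, tsupport (χ k) ⊆ (extChartAt (𝓡 n) (k : N)).source) ∧ ∀ q, ∑ k, χ k q = 1 := by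
  obtain ⟨s, -, hs⟩ := isCompact_univ.elim_nhds_subcover
    (fun p : N => (extChartAt (𝓡 n) p).source) fun p _ => extChartAt_source_mem_nhds p
  obtain ⟨ρ, hρ⟩ := SmoothPartitionOfUnity.exists_isSubordinate (𝓡 n) (isClosed_univ (X := N))
    (fun p : s => (extChartAt (𝓡 n) (p : N)).source) (fun p => isOpen_extChartAt_source (p : N))
    (hs.trans (by simp [iUnion_subtype]))
  refine ⟨s, fun k => ρ k, fun k => (ρ k).contMDiff, fun k q => ρ.nonneg k q, hρ, fun q => ?_⟩
  rw [← finsum_eq_sum_of_fintype]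
  exact ρ.sum_eq_one (mem_univ q)

end ChartCutoff

end MCF

end

noncomputable section

namespace MCF

/-! ### The localized monotonicity inequality in one chart. -/

section Monotonicity

open Set MeasureTheory Filter

variable {n : ℕ} {N : Type*} [TopologicalSpace N] [ChartedSpace (EuclideanSpace ℝ (Fin n)) N]

/-- The backward heat kernel centered at `(x₀, s)`, up to the factor `(4π)^{-n/2}`. -/
def heatKernel (n : ℕ) (s : ℝ) (x₀ : Ambient n) (t : ℝ) (x : Ambient n) : ℝ :=
  Real.exp (-(n / 2) * Real.log (s - t) - ‖x - x₀‖ ^ 2 / (4 * (s - t)))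

theorem continuous_heatKernel (s : ℝ) (x₀ : Ambient n) (t : ℝ) :
    Continuous (heatKernel n s x₀ t) := by
  unfold heatKernel
  fun_prop

/-- The contribution of the chart at `p` to the Gaussian area. -/
def chartGaussArea (F : ℝ → N → Ambient n) (s : ℝ) (x₀ : Ambient n) (χ : N → ℝ) (p : N)
    (t : ℝ) : ℝ :=
  ∫ u, chartCutoff χ p u * (heatDensity n (timeLeft n s) x₀ (flowParam F p) (t, u) *
    areaDensity (F t) p u)

variable [IsManifold (𝓡 n) ∞ N] {t₀ t₁ : ℝ} {F : ℝ → N → Ambient n}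

theorem contDiffOn_heatFlux_flowParam (hF : IsMeanCurvatureFlow t₀ t₁ F) (x₀ : Ambient n) {s t : ℝ}
    (p : N) (ht : t ∈ Ioo t₀ t₁) (hts : t < s) (i : Fin n) :
    ContDiffOn ℝ ∞ (fun u => heatFlux n (timeLeft n s) x₀ (flowParam F p) (spaceVec n) i (t, u))
      (extChartAt (𝓡 n) p).target := fun u hu =>
  ((contDiffAt_heatFlux n x₀ (contDiffAt_flowParam hF ht hu) (det_gramAt_flowParam_pos hF ht hu)
    (contDiff_timeLeft n s).contDiffAt (sub_pos.2 hts) i).comp u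
      (contDiffAt_const.prodMk contDiffAt_id)).contDiffWithinAt

variable [CompactSpace N]

/-- Derivatives are computed only at interior times; continuity at `t₀` is what lets monotonicity
start from the initial hypersurface. The interval stops at `s`, where the kernel is singular. -/
theorem continuousOn_chartGaussArea (hF : IsMeanCurvatureFlow t₀ t₁ F) (x₀ : Ambient n) {s : ℝ}
    {χ : N → ℝ} {p : N} (hχ : ContMDiff (𝓡 n) 𝓘(ℝ, ℝ) ∞ χ)
    (hs : tsupport χ ⊆ (extChartAt (𝓡 n) p).source) :
    ContinuousOn (chartGaussArea F s x₀ χ p) (Ico t₀ (min t₁ s)) := by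
  have hU : IsOpen (extChartAt (𝓡 n) p).target := isOpen_extChartAt_target p
  refine continuousOn_integral_of_compact_support (hasCompactSupport_chartCutoff hs)
    (f := fun t u => chartCutoff χ p u *
      (heatDensity n (timeLeft n s) x₀ (flowParam F p) (t, u) * areaDensity (F t) p u)) ?_
    fun t u _ hu => by rw [image_eq_zero_of_notMem_tsupport hu, zero_mul]
  refine continuousOn_cutoff_mul (contDiff_chartCutoff hχ hs).continuous
    (tsupport_chartCutoff_subset hs) hU (Q := fun z =>
      heatDensity n (timeLeft n s) x₀ (flowParam F p) z * areaDensity (F z.1) p z.2) ?_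
  have hsub : Ico t₀ (min t₁ s) ×ˢ (extChartAt (𝓡 n) p).target ⊆
      Ico t₀ t₁ ×ˢ (extChartAt (𝓡 n) p).target :=
    prod_mono (Ico_subset_Ico_right (min_le_left _ _)) subset_rfl
  have hcd := contDiffOn_flowParam hF p
  have hτ : ContinuousOn (timeLeft n s) (Ico t₀ (min t₁ s) ×ˢ (extChartAt (𝓡 n) p).target) :=
    (contDiff_timeLeft n s).continuous.continuousOn
  have hτ0 : ∀ z ∈ Ico t₀ (min t₁ s) ×ˢ (extChartAt (𝓡 n) p).target, timeLeft n s z ≠ 0 :=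
    fun z hz => (sub_pos.2 (hz.1.2.trans_le (min_le_right _ _))).ne'
  refine ContinuousOn.mul ?_ ?_
  · refine Real.continuous_exp.comp_continuousOn ?_
    exact (continuousOn_const.mul (hτ.log hτ0)).sub
      ((((hcd.continuousOn.mono hsub).sub continuousOn_const).norm.pow 2).div
        (continuousOn_const.mul hτ) fun z hz => mul_ne_zero four_ne_zero (hτ0 z hz))
  · have hfd : ContinuousOn (fun z => fderivWithin ℝ (flowParam F p)
        (Ico t₀ t₁ ×ˢ (extChartAt (𝓡 n) p).target) z)
        (Ico t₀ t₁ ×ˢ (extChartAt (𝓡 n) p).target) :=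
      hcd.continuousOn_fderivWithin ((uniqueDiffOn_Ico t₀ t₁).prod hU.uniqueDiffOn) (by simp)
    have h1 : ContinuousOn (fun z : ℝ × EuclideanSpace ℝ (Fin n) =>
        fderiv ℝ (localParam (F z.1) p) z.2) (Ico t₀ t₁ ×ˢ (extChartAt (𝓡 n) p).target) :=
      (hfd.clm_comp continuousOn_const).congr fun z hz =>
        fderiv_localParam_eq_fderivWithin hF hz.1 hz.2
    exact continuous_normDet.comp_continuousOn (h1.mono hsub)

/-- The flux through the chart at `p` caused by a cutoff function. -/
def chartFlux (F : ℝ → N → Ambient n) (s : ℝ) (x₀ : Ambient n) (χ : N → ℝ) (p : N)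
    (t : ℝ) : ℝ :=
  ∫ u, ∑ i, fderiv ℝ (chartCutoff χ p) u (EuclideanSpace.single i 1) *
    heatFlux n (timeLeft n s) x₀ (flowParam F p) (spaceVec n) i (t, u)

theorem integrable_chartFlux (hF : IsMeanCurvatureFlow t₀ t₁ F) (x₀ : Ambient n) {s t : ℝ}
    {χ : N → ℝ} {p : N} (hχ : ContMDiff (𝓡 n) 𝓘(ℝ, ℝ) ∞ χ)
    (hs : tsupport χ ⊆ (extChartAt (𝓡 n) p).source) (ht : t ∈ Ioo t₀ t₁) (hts : t < s)
    (i : Fin n) :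
    Integrable fun u => fderiv ℝ (chartCutoff χ p) u (EuclideanSpace.single i 1) *
      heatFlux n (timeLeft n s) x₀ (flowParam F p) (spaceVec n) i (t, u) := by
  have hsm := contDiff_chartCutoff hχ hs
  exact integrable_cutoff_mul ((hsm.continuous_fderiv (by simp)).clm_apply continuous_const)
    ((hasCompactSupport_chartCutoff hs).fderiv_apply ℝ _)
    ((tsupport_fderiv_apply_subset ℝ _).trans (tsupport_chartCutoff_subset hs))
    (isOpen_extChartAt_target p)
    (contDiffOn_heatFlux_flowParam hF x₀ p ht hts i).continuousOn

/-- Differentiate under the integral, multiply the pointwise inequality by `χ ≥ 0`, and move the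
divergence onto `χ` by parts. -/
theorem exists_hasDerivAt_chartGaussArea (hF : IsMeanCurvatureFlow t₀ t₁ F) (x₀ : Ambient n)
    {s t : ℝ} {χ : N → ℝ} {p : N} (hχ : ContMDiff (𝓡 n) 𝓘(ℝ, ℝ) ∞ χ) (hχ0 : ∀ q, 0 ≤ χ q)
    (hs : tsupport χ ⊆ (extChartAt (𝓡 n) p).source) (ht : t ∈ Ioo t₀ t₁) (hts : t < s) :
    ∃ D ≤ chartFlux F s x₀ χ p t, HasDerivAt (chartGaussArea F s x₀ χ p) D t := by
  have hU : IsOpen (extChartAt (𝓡 n) p).target := isOpen_extChartAt_target p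
  have hsm := contDiff_chartCutoff hχ hs
  have hcs := hasCompactSupport_chartCutoff hs
  have hsupp := tsupport_chartCutoff_subset hs
  set Q : ℝ × EuclideanSpace ℝ (Fin n) → ℝ := fun z =>
    heatDensity n (timeLeft n s) x₀ (flowParam F p) z *
      volDensity (flowParam F p) (spaceVec n) z with hQ
  have hQc : ContDiffOn ℝ ∞ Q (Ioo t₀ (min t₁ s) ×ˢ (extChartAt (𝓡 n) p).target) := by
    rintro ⟨r, u⟩ ⟨hr, hu⟩
    have hr' : r ∈ Ioo t₀ t₁ := ⟨hr.1, hr.2.trans_le (min_le_left _ _)⟩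
    have hrs : r < s := hr.2.trans_le (min_le_right _ _)
    have hfp := contDiffAt_flowParam hF hr' hu
    exact ((contDiffAt_heatDensity n x₀ hfp (contDiff_timeLeft n s).contDiffAt (sub_pos.2 hrs)).mul
      (contDiffAt_volDensity hfp (det_gramAt_flowParam_pos hF hr' hu))).contDiffWithinAt
  have htm : t ∈ Ioo t₀ (min t₁ s) := ⟨ht.1, lt_min ht.2 hts⟩
  have hder := hasDerivAt_integral_cutoff_mul (μ := volume) htm hsm.continuous hcs hsupp hU hQc
  refine ⟨_, ?_, hder.congr_of_eventuallyEq ?_⟩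
  · have hint : ∀ i, Integrable fun u => chartCutoff χ p u * fderiv ℝ (fun u =>
        heatFlux n (timeLeft n s) x₀ (flowParam F p) (spaceVec n) i (t, u)) u
          (EuclideanSpace.single i 1) := fun i =>
      integrable_cutoff_mul hsm.continuous hcs hsupp hU
        (((contDiffOn_heatFlux_flowParam hF x₀ p ht hts i).continuousOn_fderiv_of_isOpen hU
          (by simp)).clm_apply continuousOn_const)
    have hflux : chartFlux F s x₀ χ p t = ∫ u, -∑ i, chartCutoff χ p u * fderiv ℝ (fun u =>
        heatFlux n (timeLeft n s) x₀ (flowParam F p) (spaceVec n) i (t, u)) u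
          (EuclideanSpace.single i 1) := by
      rw [chartFlux, integral_finsetSum _ fun i _ => integrable_chartFlux hF x₀ hχ hs ht hts i,
        integral_neg, integral_finsetSum _ fun i _ => hint i, ← Finset.sum_neg_distrib]
      refine Finset.sum_congr rfl fun i _ => ?_
      rw [integral_cutoff_mul_fderiv hsm hcs hsupp hU
        (contDiffOn_heatFlux_flowParam hF x₀ p ht hts i), neg_neg]
    rw [hflux]
    refine integral_mono ?_ (integrable_finsetSum _ fun i _ => hint i).neg fun u => ?_
    · have hO : IsOpen (Ioo t₀ (min t₁ s) ×ˢ (extChartAt (𝓡 n) p).target) := isOpen_Ioo.prod hU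
      exact integrable_cutoff_mul hsm.continuous hcs hsupp hU
        (((hQc.continuousOn_fderiv_of_isOpen hO (by simp)).clm_apply continuousOn_const).comp
          (by fun_prop) fun u hu => ⟨htm, hu⟩)
    · dsimp only
      rw [← Finset.mul_sum, ← mul_neg]
      by_cases hu : u ∈ (extChartAt (𝓡 n) p).target
      · refine mul_le_mul_of_nonneg_left ?_ (by rw [chartCutoff_of_mem χ hu]; exact hχ0 _)
        have hmain := fderiv_heatDensity_flowParam_le hF ht hu x₀ hts
        have hsl : ∀ i, fderiv ℝ (fun u =>
            heatFlux n (timeLeft n s) x₀ (flowParam F p) (spaceVec n) i (t, u)) u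
              (EuclideanSpace.single i 1) =
            fderiv ℝ (heatFlux n (timeLeft n s) x₀ (flowParam F p) (spaceVec n) i) (t, u)
              (spaceVec n i) := by
          intro i
          have hd := (contDiffAt_heatFlux n x₀ (contDiffAt_flowParam hF ht hu)
            (det_gramAt_flowParam_pos hF ht hu) (contDiff_timeLeft n s).contDiffAt
            (sub_pos.2 hts) i).differentiableAt (by simp)
          have h1 := (hd.hasFDerivAt.comp u (hasFDerivAt_prodMk_right t u)).fderiv
          exact (DFunLike.congr_fun h1 _).trans (by simp [spaceVec])
        simp_rw [hsl]
        have : fderiv ℝ Q (t, u) (1, 0) = fderiv ℝ Q (t, u) (timeVec n) := rfl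
        rw [this]
        linarith
      · rw [image_eq_zero_of_notMem_tsupport fun h => hu (hsupp h), zero_mul, zero_mul]
  · filter_upwards [Ioo_mem_nhds ht.1 ht.2] with r hr
    refine integral_congr_ae (Eventually.of_forall fun u => ?_)
    by_cases hu : u ∈ (extChartAt (𝓡 n) p).target
    · simp only [hQ, volDensity_flowParam hF hr hu, areaDensity]
    · simp only [image_eq_zero_of_notMem_tsupport fun h => hu (hsupp h), zero_mul]

end Monotonicity

end MCF

end

noncomputable section

namespace MCF

/-! ### Cancellation of the fluxes between charts, and Huisken's formula. -/

section Flux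

open Set MeasureTheory Filter

variable {n : ℕ} {N : Type*} [TopologicalSpace N] [ChartedSpace (EuclideanSpace ℝ (Fin n)) N]

/-- The inner product of the gradients of `χ` and of the backward heat kernel on the hypersurface
at time `t`. -/
def fluxDensity (F : ℝ → N → Ambient n) (s : ℝ) (x₀ : Ambient n) (χ : N → ℝ) (t : ℝ) (q : N) : ℝ :=
  ∑ i, ∑ j, (Matrix.gram ℝ fun i => fderiv ℝ (localParam (F t) q) (extChartAt (𝓡 n) q q)
      (EuclideanSpace.single i 1))⁻¹ i j *
    (fderiv ℝ (χ ∘ (extChartAt (𝓡 n) q).symm) (extChartAt (𝓡 n) q q) (EuclideanSpace.single i 1) *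
      (-(heatKernel n s x₀ t (F t q) / (2 * (s - t))) *
        inner ℝ (F t q - x₀) (fderiv ℝ (localParam (F t) q) (extChartAt (𝓡 n) q q)
          (EuclideanSpace.single j 1))))

theorem fluxDensity_eq_zero_of_notMem_tsupport (F : ℝ → N → Ambient n) (s : ℝ) (x₀ : Ambient n)
    {χ : N → ℝ} (t : ℝ) {q : N} (hq : q ∉ tsupport χ) : fluxDensity F s x₀ χ t q = 0 := by
  have hev : χ ∘ (extChartAt (𝓡 n) q).symm =ᶠ[𝓝 (extChartAt (𝓡 n) q q)] fun _ => 0 := by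
    have h1 : ContinuousAt (extChartAt (𝓡 n) q).symm (extChartAt (𝓡 n) q q) :=
      continuousAt_extChartAt_symm q
    have h2 : (tsupport χ)ᶜ ∈ 𝓝 ((extChartAt (𝓡 n) q).symm (extChartAt (𝓡 n) q q)) := by
      rw [extChartAt_to_inv]
      exact (isClosed_tsupport χ).isOpen_compl.mem_nhds hq
    filter_upwards [h1.preimage_mem_nhds h2] with y hy
    exact image_eq_zero_of_notMem_tsupport (f := χ) hy
  refine Finset.sum_eq_zero fun i _ => Finset.sum_eq_zero fun j _ => ?_
  rw [hev.fderiv_eq, fderiv_fun_const]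
  simp only [Pi.zero_apply, zero_apply, zero_mul, mul_zero]

variable [IsManifold (𝓡 n) ∞ N] {t₀ t₁ : ℝ} {F : ℝ → N → Ambient n}

/-- The density is linear in `dχ`, and the differentials of a partition of unity sum to zero. -/
theorem sum_fluxDensity {κ : Type*} [Fintype κ] {χ : κ → N → ℝ}
    (hχ : ∀ k, ContMDiff (𝓡 n) 𝓘(ℝ, ℝ) ∞ (χ k)) (hsum : ∀ q, ∑ k, χ k q = 1) (s : ℝ)
    (x₀ : Ambient n) (t : ℝ) (q : N) : ∑ k, fluxDensity F s x₀ (χ k) t q = 0 := by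
  have hd : ∀ k, DifferentiableAt ℝ (χ k ∘ (extChartAt (𝓡 n) q).symm) (extChartAt (𝓡 n) q q) :=
    fun k => (contDiffAt_comp_extChartAt_symm (hχ k) q
      (mem_extChartAt_target q)).differentiableAt (by simp)
  have hz : ∀ v, ∑ k, fderiv ℝ (χ k ∘ (extChartAt (𝓡 n) q).symm) (extChartAt (𝓡 n) q q) v = 0 := by
    intro v
    have h1 : fderiv ℝ (fun u => ∑ k, (χ k ∘ (extChartAt (𝓡 n) q).symm) u)
        (extChartAt (𝓡 n) q q) = 0 := by
      simp [hsum]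
    rw [fderiv_fun_sum fun k _ => hd k] at h1
    simpa using DFunLike.congr_fun h1 v
  simp only [fluxDensity]
  rw [Finset.sum_comm]
  refine Finset.sum_eq_zero fun i _ => ?_
  rw [Finset.sum_comm]
  refine Finset.sum_eq_zero fun j _ => ?_
  rw [← Finset.mul_sum, ← Finset.sum_mul, hz, zero_mul, mul_zero]

/-- The heat flux is `√det g · g^{ij} ∂_j Φ`, so the left side is `√det g` times the metric trace of
`dχ ⊗ dΦ`. That trace may be evaluated in the preferred chart at the point instead of the chart at
`p`. -/
theorem sum_fderiv_chartCutoff_mul_heatFlux (hF : IsMeanCurvatureFlow t₀ t₁ F) (x₀ : Ambient n)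
    (s : ℝ) {t : ℝ} {χ : N → ℝ} {p : N} (hχ : ContMDiff (𝓡 n) 𝓘(ℝ, ℝ) ∞ χ) (ht : t ∈ Ioo t₀ t₁)
    {u : EuclideanSpace ℝ (Fin n)} (hu : u ∈ (extChartAt (𝓡 n) p).target) :
    ∑ i, fderiv ℝ (chartCutoff χ p) u (EuclideanSpace.single i 1) *
      heatFlux n (timeLeft n s) x₀ (flowParam F p) (spaceVec n) i (t, u) =
    areaDensity (F t) p u * fluxDensity F s x₀ χ t ((extChartAt (𝓡 n) p).symm u) := by
  set q := (extChartAt (𝓡 n) p).symm u with hqdef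
  have hhyp := hF.hypersurface t (Ioo_subset_Ico_self ht)
  have hq : q ∈ (extChartAt (𝓡 n) q).source := mem_extChartAt_source q
  have hqt : coordChange n p q u ∈ (extChartAt (𝓡 n) q).target :=
    (extChartAt (𝓡 n) q).map_source hq
  set c : ℝ := -(heatKernel n s x₀ t (F t q) / (2 * (s - t))) with hc
  set β : LinearMap.BilinForm ℝ (EuclideanSpace ℝ (Fin n)) :=
    LinearMap.mk₂ ℝ (fun v w => fderiv ℝ (χ ∘ (extChartAt (𝓡 n) q).symm) (coordChange n p q u) v *
      (c * inner ℝ (F t q - x₀) (fderiv ℝ (localParam (F t) q) (coordChange n p q u) w)))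
      (fun _ _ _ => by simp [add_mul]) (fun _ _ _ => by simp [mul_assoc])
      (fun _ _ _ => by simp [inner_add_right, mul_add])
      (fun _ _ _ => by simp [inner_smul_right]; ring) with hβ
  have hθ : DifferentiableAt ℝ (coordChange n p q) u :=
    (contDiffAt_coordChange hu hq).differentiableAt (by simp)
  have hβθ : ∀ v w, β (fderiv ℝ (coordChange n p q) u v) (fderiv ℝ (coordChange n p q) u w) =
      fderiv ℝ (chartCutoff χ p) u v *
        (c * inner ℝ (F t q - x₀) (fderiv ℝ (localParam (F t) p) u w)) := by
    intro v w
    have h1 : fderiv ℝ (chartCutoff χ p) u =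
        (fderiv ℝ (χ ∘ (extChartAt (𝓡 n) q).symm) (coordChange n p q u)).comp
          (fderiv ℝ (coordChange n p q) u) := by
      rw [(chartCutoff_eventuallyEq χ hu).fderiv_eq,
        (comp_extChartAt_symm_eventuallyEq χ hu hq).fderiv_eq]
      exact fderiv_comp u ((contDiffAt_comp_extChartAt_symm hχ q hqt).differentiableAt (by simp)) hθ
    have h2 : fderiv ℝ (localParam (F t) p) u =
        (fderiv ℝ (localParam (F t) q) (coordChange n p q u)).comp
          (fderiv ℝ (coordChange n p q) u) :=
      (comp_extChartAt_symm_eventuallyEq (F t) hu hq).fderiv_eq.trans (fderiv_comp u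
        ((contDiffAt_comp_extChartAt_symm hhyp.smooth q hqt).differentiableAt (by simp)) hθ)
    rw [h1, h2]
    rfl
  have hinv := sum_inv_gram_localParam_eq hhyp hu hq β
  simp_rw [hβθ] at hinv
  have hdens : fluxDensity F s x₀ χ t q = ∑ i, ∑ j, (Matrix.gram ℝ fun i =>
      fderiv ℝ (localParam (F t) q) (coordChange n p q u) (EuclideanSpace.single i 1))⁻¹ i j *
      β (EuclideanSpace.single i 1) (EuclideanSpace.single j 1) := rfl
  rw [hdens, ← hinv, ← gramAt_flowParam hF ht hu, Finset.mul_sum]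
  refine Finset.sum_congr rfl fun i _ => ?_
  have hflux : heatFlux n (timeLeft n s) x₀ (flowParam F p) (spaceVec n) i (t, u) =
      c * inner ℝ (F t q - x₀) (conormal (flowParam F p) (spaceVec n) i (t, u)) := rfl
  rw [hflux, conormal, inner_sum, Finset.mul_sum, Finset.mul_sum, Finset.mul_sum]
  refine Finset.sum_congr rfl fun j _ => ?_
  rw [inner_smul_right, volDensity_flowParam hF ht hu, fderiv_localParam_apply hF ht hu,
    areaDensity, spaceVec]
  ring

variable [CompactSpace N]

/-- Rewrites a chart integral over a single measure independent of the chart, so that the fluxes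
from different charts can be added pointwise. -/
theorem chartFlux_eq [MeasurableSpace N] [BorelSpace N] (hF : IsMeanCurvatureFlow t₀ t₁ F)
    (x₀ : Ambient n) {s t : ℝ} {χ : N → ℝ} {p : N} (hχ : ContMDiff (𝓡 n) 𝓘(ℝ, ℝ) ∞ χ)
    (hs : tsupport χ ⊆ (extChartAt (𝓡 n) p).source) (ht : t ∈ Ioo t₀ t₁) (hts : t < s) :
    Integrable (fluxDensity F s x₀ χ t) (hypMeasure (F t)) ∧
      chartFlux F s x₀ χ p t = ∫ q, fluxDensity F s x₀ χ t q ∂(hypMeasure (F t)) := by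
  have hhyp := hF.hypersurface t (Ioo_subset_Ico_self ht)
  have hU : IsOpen (extChartAt (𝓡 n) p).target := isOpen_extChartAt_target p
  have hw : ∀ q ∉ (extChartAt (𝓡 n) p).source, fluxDensity F s x₀ χ t q = 0 := fun q hq =>
    fluxDensity_eq_zero_of_notMem_tsupport F s x₀ t fun h => hq (hs h)
  have hcongr : EqOn (fun u => ∑ i, fderiv ℝ (chartCutoff χ p) u (EuclideanSpace.single i 1) *
      heatFlux n (timeLeft n s) x₀ (flowParam F p) (spaceVec n) i (t, u))
      (fun u => areaDensity (F t) p u * fluxDensity F s x₀ χ t ((extChartAt (𝓡 n) p).symm u))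
      (extChartAt (𝓡 n) p).target := fun u hu =>
    sum_fderiv_chartCutoff_mul_heatFlux hF x₀ s hχ ht hu
  constructor
  · rw [integrable_hypMeasure_iff hhyp p hw]
    refine IntegrableOn.congr_fun ?_ hcongr hU.measurableSet
    exact (integrable_finsetSum _ fun i _ =>
      integrable_chartFlux hF x₀ hχ hs ht hts i).integrableOn
  · rw [integral_hypMeasure_eq hhyp p hw, ← setIntegral_congr_fun hU.measurableSet hcongr,
      chartFlux]
    refine (setIntegral_eq_integral_of_forall_compl_eq_zero fun u hu => ?_).symm
    refine Finset.sum_eq_zero fun i _ => ?_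
    have : u ∉ tsupport (fun u => fderiv ℝ (chartCutoff χ p) u (EuclideanSpace.single i 1)) :=
      fun h => hu (tsupport_chartCutoff_subset hs (tsupport_fderiv_apply_subset ℝ _ h))
    have h0 := image_eq_zero_of_notMem_tsupport this
    rw [h0, zero_mul]

theorem chartGaussArea_eq [MeasurableSpace N] [BorelSpace N] (hF : IsMeanCurvatureFlow t₀ t₁ F)
    (x₀ : Ambient n) (s : ℝ) {t : ℝ} {χ : N → ℝ} {p : N}
    (hs : tsupport χ ⊆ (extChartAt (𝓡 n) p).source) (ht : t ∈ Ico t₀ t₁) :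
    chartGaussArea F s x₀ χ p t =
      ∫ q, χ q * heatKernel n s x₀ t (F t q) ∂(hypMeasure (F t)) := by
  have hhyp := hF.hypersurface t ht
  have hU : IsOpen (extChartAt (𝓡 n) p).target := isOpen_extChartAt_target p
  rw [integral_hypMeasure_eq hhyp p fun q hq => by
    rw [image_eq_zero_of_notMem_tsupport fun h => hq (hs h), zero_mul], chartGaussArea,
    ← setIntegral_eq_integral_of_forall_compl_eq_zero (s := (extChartAt (𝓡 n) p).target)
      fun u hu => by rw [chartCutoff, indicator_of_notMem hu, zero_mul]]
  refine setIntegral_congr_fun hU.measurableSet fun u hu => ?_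
  have hk : heatDensity n (timeLeft n s) x₀ (flowParam F p) (t, u) =
      heatKernel n s x₀ t (F t ((extChartAt (𝓡 n) p).symm u)) := rfl
  simp only [chartCutoff_of_mem χ hu, hk]
  ring

/-- **Huisken's monotonicity formula**: the Gaussian area is non-increasing along the flow. -/
theorem antitoneOn_integral_heatKernel [T2Space N] [MeasurableSpace N] [BorelSpace N]
    (hF : IsMeanCurvatureFlow t₀ t₁ F) (x₀ : Ambient n) (s : ℝ) :
    AntitoneOn (fun t => ∫ q, heatKernel n s x₀ t (F t q) ∂(hypMeasure (F t)))
      (Ico t₀ (min t₁ s)) := by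
  obtain ⟨S, χ, hχ, hχ0, hsupp, hsum⟩ := exists_finite_partition n N
  have heq : EqOn (fun t => ∑ k, chartGaussArea F s x₀ (χ k) k t)
      (fun t => ∫ q, heatKernel n s x₀ t (F t q) ∂(hypMeasure (F t))) (Ico t₀ (min t₁ s)) := by
    intro t ht
    have ht' : t ∈ Ico t₀ t₁ := Ico_subset_Ico_right (min_le_left _ _) ht
    have hhyp := hF.hypersurface t ht'
    have := isFiniteMeasure_hypMeasure hhyp
    have hcont : ∀ k, Continuous fun q => χ k q * heatKernel n s x₀ t (F t q) := fun k =>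
      (hχ k).continuous.mul ((continuous_heatKernel s x₀ t).comp hhyp.smooth.continuous)
    dsimp only
    simp_rw [fun k : S => chartGaussArea_eq hF x₀ s (hsupp k) ht']
    rw [← integral_finsetSum _ fun k _ => (hcont k).integrable_of_hasCompactSupport
      (HasCompactSupport.of_compactSpace _)]
    refine integral_congr_ae (Eventually.of_forall fun q => ?_)
    simp only [← Finset.sum_mul, hsum, one_mul]
  refine AntitoneOn.congr ?_ heq
  have hex : ∀ t ∈ Ioo t₀ (min t₁ s), ∃ D ≤ 0,
      HasDerivAt (fun t => ∑ k, chartGaussArea F s x₀ (χ k) k t) D t := by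
    intro t ht
    have ht' : t ∈ Ioo t₀ t₁ := ⟨ht.1, ht.2.trans_le (min_le_left _ _)⟩
    have hts : t < s := ht.2.trans_le (min_le_right _ _)
    choose D hD hder using fun k : S =>
      exists_hasDerivAt_chartGaussArea hF x₀ (hχ k) (hχ0 k) (hsupp k) ht' hts
    refine ⟨∑ k, D k, (Finset.sum_le_sum fun k _ => hD k).trans ?_,
      HasDerivAt.fun_sum fun k _ => hder k⟩
    -- Only after the fluxes are integrals over the common area measure does their sum vanish
    -- pointwise.
    have hflux := fun k : S => chartFlux_eq hF x₀ (hχ k) (hsupp k) ht' hts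
    rw [Finset.sum_congr rfl fun k _ => (hflux k).2,
      ← integral_finsetSum _ fun k _ => (hflux k).1]
    simp only [sum_fluxDensity hχ hsum, integral_zero, le_refl]
  refine antitoneOn_of_deriv_nonpos (convex_Ico _ _) ?_ ?_ ?_
  · exact continuousOn_finsetSum _ fun k _ => continuousOn_chartGaussArea hF x₀ (hχ k) (hsupp k)
  · rw [interior_Ico]
    intro t ht
    obtain ⟨D, -, hD⟩ := hex t ht
    exact hD.differentiableAt.differentiableWithinAt
  · rw [interior_Ico]
    intro t ht
    obtain ⟨D, hD0, hD⟩ := hex t ht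
    rw [hD.deriv]
    exact hD0

end Flux

end MCF

end

noncomputable section

namespace MCF

open MeasureTheory Set Filter

/-! ### Gaussian functionals under flow, rescaling and limits -/

/-- The weight `(4πt)^{-n/2} exp(-|x-x₀|²/(4t))` integrated by `gaussianF`. -/
def gaussianWeight (n : ℕ) (x₀ : Ambient n) (t : ℝ) (x : Ambient n) : ℝ :=
  (4 * Real.pi * t) ^ (-(n : ℝ) / 2) * Real.exp (-‖x - x₀‖ ^ 2 / (4 * t))

theorem continuous_gaussianWeight (n : ℕ) (x₀ : Ambient n) (t : ℝ) :
    Continuous (gaussianWeight n x₀ t) := by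
  unfold gaussianWeight
  fun_prop

theorem gaussianWeight_nonneg (n : ℕ) (x₀ : Ambient n) {t : ℝ} (ht : 0 < t) (x : Ambient n) :
    0 ≤ gaussianWeight n x₀ t x := by
  unfold gaussianWeight
  positivity

theorem gaussianF_eq_lintegral (n : ℕ) (x₀ : Ambient n) {t : ℝ} (ht : 0 < t)
    (μ : Measure (Ambient n)) :
    gaussianF n x₀ t μ = ∫⁻ x, ENNReal.ofReal (gaussianWeight n x₀ t x) ∂μ := by
  rw [gaussianF, ← lintegral_const_mul' _ _ ENNReal.ofReal_ne_top]
  refine lintegral_congr fun x => ?_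
  rw [gaussianWeight, ENNReal.ofReal_mul (by positivity)]

theorem gaussianWeight_eq_heatKernel (n : ℕ) (x₀ : Ambient n) {s t : ℝ} (h : t < s)
    (x : Ambient n) : gaussianWeight n x₀ (s - t) x =
      (4 * Real.pi) ^ (-(n : ℝ) / 2) * heatKernel n s x₀ t x := by
  have h' : 0 < s - t := sub_pos.2 h
  rw [gaussianWeight, heatKernel, Real.mul_rpow (by positivity) h'.le,
    Real.rpow_def_of_pos h', mul_assoc, ← Real.exp_add]
  congr 2
  ring

/-- The factor `r ^ n` is the growth of `n`-dimensional area under dilation by `r`, and it turns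
`t^{-n/2}` into `(t/r²)^{-n/2}`. This is the parabolic scale invariance of the Gaussian functional.
-/
theorem gaussianWeight_smul_sub (n : ℕ) (x₀ y : Ambient n) {t r : ℝ} (ht : 0 < t) (hr : 0 < r)
    (x : Ambient n) : r ^ n * gaussianWeight n x₀ t (r • (x - y)) =
      gaussianWeight n (y + r⁻¹ • x₀) (t / r ^ 2) x := by
  have hnorm : ‖r • (x - y) - x₀‖ = r * ‖x - (y + r⁻¹ • x₀)‖ := by
    rw [← abs_of_pos hr, ← Real.norm_eq_abs, ← norm_smul, Real.norm_eq_abs, abs_of_pos hr]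
    congr 1
    rw [smul_sub, smul_sub, smul_add, smul_inv_smul₀ hr.ne', sub_sub]
  have hpow : (4 * Real.pi * (t / r ^ 2)) ^ (-(n : ℝ) / 2) =
      r ^ n * (4 * Real.pi * t) ^ (-(n : ℝ) / 2) := by
    have h2 : (r ^ 2) ^ (-(n : ℝ) / 2) = (r ^ n)⁻¹ := by
      rw [← Real.rpow_natCast r 2, ← Real.rpow_mul hr.le, ← Real.rpow_natCast r n,
        ← Real.rpow_neg hr.le]
      congr 1
      push_cast
      ring
    rw [← mul_div_assoc, Real.div_rpow (by positivity) (by positivity), h2, div_inv_eq_mul,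
      mul_comm]
  rw [gaussianWeight, gaussianWeight, hnorm, hpow, ← mul_assoc]
  congr 2
  field_simp

theorem euclideanHausdorffMeasure_image_smul_sub {n : ℕ} (d : ℕ) {r : ℝ} (hr : 0 < r)
    (y : Ambient n) (A : Set (Ambient n)) :
    (μHE[d] : Measure (Ambient n)) ((fun x => r • (x - y)) '' A) =
      ENNReal.ofReal (r ^ d) * (μHE[d] : Measure (Ambient n)) A := by
  have h : (fun x => r • (x - y)) '' A = r • ((fun x => x - y) '' A) := by
    rw [← image_smul, image_image]
  have hiso : Isometry fun x : Ambient n => x - y := by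
    simpa [sub_eq_add_neg] using isometry_add_right (-y)
  rw [h, Measure.euclideanHausdorffMeasure_smul₀ d hr.ne', hiso.euclideanHausdorffMeasure_image]
  rw [ENNReal.smul_def, smul_eq_mul]
  congr 1
  rw [ENNReal.coe_pow, ENNReal.ofReal_pow hr.le, ← Real.enorm_eq_ofReal hr.le, enorm_eq_nnnorm]

theorem measurableEmbedding_smul_sub {n : ℕ} {r : ℝ} (hr : 0 < r) (y : Ambient n) :
    MeasurableEmbedding fun x : Ambient n => r • (x - y) :=
  ((Homeomorph.subRight y).trans (Homeomorph.smulOfNeZero r hr.ne')).measurableEmbedding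

theorem areaMeasure_image_smul_sub {n : ℕ} {r : ℝ} (hr : 0 < r) (y : Ambient n)
    (A : Set (Ambient n)) :
    areaMeasure n 1 ((fun x => r • (x - y)) '' A) =
      ENNReal.ofReal (r ^ n) • (areaMeasure n 1 A).map fun x => r • (x - y) := by
  have hD := measurableEmbedding_smul_sub hr y
  ext E hE
  simp only [areaMeasure, Nat.cast_one, one_smul, Measure.smul_apply, smul_eq_mul]
  rw [Measure.restrict_apply hE, hD.map_apply, Measure.restrict_apply (hD.measurable hE),
    ← euclideanHausdorffMeasure_image_smul_sub n hr, image_preimage_inter]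

theorem gaussianF_image_smul_sub {n : ℕ} (x₀ y : Ambient n) {t r : ℝ} (ht : 0 < t) (hr : 0 < r)
    (A : Set (Ambient n)) :
    gaussianF n x₀ t (areaMeasure n 1 ((fun x => r • (x - y)) '' A)) =
      gaussianF n (y + r⁻¹ • x₀) (t / r ^ 2) (areaMeasure n 1 A) := by
  rw [gaussianF_eq_lintegral n _ ht, gaussianF_eq_lintegral n _ (by positivity),
    areaMeasure_image_smul_sub hr, lintegral_smul_measure,
    (measurableEmbedding_smul_sub hr y).lintegral_map, smul_eq_mul,
    ← lintegral_const_mul' _ _ ENNReal.ofReal_ne_top]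
  refine lintegral_congr fun x => ?_
  rw [← gaussianWeight_smul_sub n x₀ y ht hr, ENNReal.ofReal_mul (by positivity)]

/-- Dominated convergence: the exponentials are at most 1 once the scale is positive, and `μ` is
finite. -/
theorem tendsto_gaussianF {n : ℕ} {ι : Type*} {l : Filter ι} [l.IsCountablyGenerated]
    (μ : Measure (Ambient n)) [IsFiniteMeasure μ] {x : ι → Ambient n} {t : ι → ℝ} {x₀ : Ambient n}
    {t₀ : ℝ} (ht₀ : 0 < t₀) (hx : Tendsto x l (𝓝 x₀)) (ht : Tendsto t l (𝓝 t₀)) :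
    Tendsto (fun i => gaussianF n (x i) (t i) μ) l (𝓝 (gaussianF n x₀ t₀ μ)) := by
  have hpos : ∀ᶠ i in l, 0 < t i := ht.eventually_const_lt ht₀
  have hint : Tendsto (fun i => ∫⁻ z, ENNReal.ofReal (Real.exp (-‖z - x i‖ ^ 2 / (4 * t i))) ∂μ) l
      (𝓝 (∫⁻ z, ENNReal.ofReal (Real.exp (-‖z - x₀‖ ^ 2 / (4 * t₀))) ∂μ)) := by
    refine tendsto_lintegral_filter_of_dominated_convergence (fun _ => 1)
      (Eventually.of_forall fun i => by fun_prop) ?_ (by simp) ?_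
    · filter_upwards [hpos] with i hi
      refine Eventually.of_forall fun z => ENNReal.ofReal_le_one.2 (Real.exp_le_one_iff.2 ?_)
      exact div_nonpos_of_nonpos_of_nonneg (neg_nonpos.2 (by positivity)) (by positivity)
    · refine Eventually.of_forall fun z => ENNReal.tendsto_ofReal ?_
      refine (Real.continuous_exp.tendsto _).comp (Tendsto.div ?_ (ht.const_mul 4) (by positivity))
      exact ((tendsto_const_nhds.sub hx).norm.pow 2).neg
  refine ENNReal.Tendsto.mul (ENNReal.tendsto_ofReal ?_) (Or.inl ?_) hint
    (Or.inr ENNReal.ofReal_ne_top)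
  · exact (ht.const_mul _).rpow_const (Or.inl (by positivity))
  · exact (ENNReal.ofReal_pos.2 (by positivity)).ne'

/-- Radon convergence tests only compactly supported functions, which a Gaussian is not. The bound
holds for cutoffs of `g` and passes to `g` by monotone convergence. -/
theorem lintegral_le_of_convergesAsRadon {n : ℕ} {μs : ℕ → Measure (Ambient n)}
    {μ : Measure (Ambient n)} [IsFiniteMeasure μ] (h : ConvergesAsRadon n μs μ)
    {g : Ambient n → ℝ} (hg : Continuous g) (hg0 : ∀ x, 0 ≤ g x) {c : ℕ → ℝ≥0∞} {C : ℝ≥0∞}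
    (hc : ∀ᶠ i in atTop, ∫⁻ x, ENNReal.ofReal (g x) ∂(μs i) ≤ c i)
    (hC : Tendsto c atTop (𝓝 C)) : ∫⁻ x, ENNReal.ofReal (g x) ∂μ ≤ C := by
  set χ : ℕ → Ambient n → ℝ := fun k x => max 0 (min 1 (k - ‖x‖)) with hχ
  have hχc : ∀ k, Continuous (χ k) := fun k => by fun_prop
  have hχ0 : ∀ k x, 0 ≤ χ k x := fun k x => le_max_left _ _
  have hχ1 : ∀ k x, χ k x ≤ 1 := fun k x => max_le zero_le_one (min_le_left _ _)
  have hsupp : ∀ k, HasCompactSupport fun x => χ k x * g x := fun k => by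
    refine HasCompactSupport.intro (isCompact_closedBall (0 : Ambient n) k) fun x hx => ?_
    have : (k : ℝ) - ‖x‖ ≤ 0 := by
      rw [mem_closedBall_zero_iff, not_le] at hx
      linarith
    simp [hχ, max_eq_left ((min_le_right _ _).trans this)]
  have hcont : ∀ k, Continuous fun x => χ k x * g x := fun k => (hχc k).mul hg
  have hbound : ∀ k, ∫⁻ x, ENNReal.ofReal (χ k x * g x) ∂μ ≤ C := by
    intro k
    rw [← ofReal_integral_eq_lintegral_ofReal ((hcont k).integrable_of_hasCompactSupport (hsupp k))
      (Eventually.of_forall fun x => mul_nonneg (hχ0 k x) (hg0 x))]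
    refine le_of_tendsto_of_tendsto (ENNReal.tendsto_ofReal (h _ (hcont k) (hsupp k))) hC ?_
    filter_upwards [hc] with i hi
    refine le_trans ?_ hi
    by_cases hint : Integrable (fun x => χ k x * g x) (μs i)
    · rw [ofReal_integral_eq_lintegral_ofReal hint
        (Eventually.of_forall fun x => mul_nonneg (hχ0 k x) (hg0 x))]
      exact lintegral_mono fun x => ENNReal.ofReal_le_ofReal
        (mul_le_of_le_one_left (hg0 x) (hχ1 k x))
    -- A non-integrable function has Bochner integral zero by convention, so the bound is trivial
    -- here.
    · simp [integral_undef hint]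
  have hlim := lintegral_tendsto_of_tendsto_of_monotone (μ := μ)
    (f := fun k x => ENNReal.ofReal (χ k x * g x)) (F := fun x => ENNReal.ofReal (g x))
    (fun k => (hcont k).measurable.ennreal_ofReal.aemeasurable)
    (Eventually.of_forall fun x k l hkl => ENNReal.ofReal_le_ofReal
      (mul_le_mul_of_nonneg_right (max_le_max le_rfl (min_le_min le_rfl
        (sub_le_sub_right (Nat.cast_le.2 hkl) _))) (hg0 x)))
    (Eventually.of_forall fun x => ENNReal.tendsto_ofReal (tendsto_const_nhds.congr' ?_))
  · exact le_of_tendsto' hlim hbound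
  · obtain ⟨K, hK⟩ := exists_nat_ge (‖x‖ + 1)
    filter_upwards [eventually_ge_atTop K] with k hk
    have : (1 : ℝ) ≤ k - ‖x‖ := by
      have : (K : ℝ) ≤ k := Nat.cast_le.2 hk
      linarith
    simp [hχ, min_eq_left this]

/-! ### Monotonicity of Gaussian functionals and the entropy bound for blow-up limits. -/

section Flow

variable {n : ℕ} {N : Type*} [TopologicalSpace N] [ChartedSpace (EuclideanSpace ℝ (Fin n)) N]
  [IsManifold (𝓡 n) ∞ N] [CompactSpace N]

theorem isFiniteMeasure_areaMeasure_range {f : N → Ambient n} (hf : IsEmbeddedHypersurface f)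
    (m : ℕ) : IsFiniteMeasure (areaMeasure n m (range f)) := by
  let _ : MeasurableSpace N := borel N
  have : BorelSpace N := ⟨rfl⟩
  have := isFiniteMeasure_hypMeasure hf
  have h := lintegral_areaMeasure_range hf fun _ => 1
  simp only [lintegral_one] at h
  have h1 : IsFiniteMeasure (areaMeasure n 1 (range f)) := ⟨h ▸ measure_lt_top _ _⟩
  have h2 : areaMeasure n m (range f) = (m : ℝ≥0∞) • areaMeasure n 1 (range f) := by
    simp [areaMeasure]
  rw [h2]
  exact ⟨by simpa using ENNReal.mul_lt_top (ENNReal.natCast_lt_top m) (measure_lt_top _ _)⟩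

theorem gaussianF_eq_ofReal_integral_heatKernel [MeasurableSpace N] [BorelSpace N]
    {f : N → Ambient n} (hf : IsEmbeddedHypersurface f) (x₀ : Ambient n) {s t : ℝ} (h : t < s) :
    gaussianF n x₀ (s - t) (areaMeasure n 1 (range f)) =
      ENNReal.ofReal ((4 * Real.pi) ^ (-(n : ℝ) / 2) *
        ∫ q, heatKernel n s x₀ t (f q) ∂(hypMeasure f)) := by
  have := isFiniteMeasure_hypMeasure hf
  rw [gaussianF_eq_lintegral n x₀ (sub_pos.2 h), lintegral_areaMeasure_range hf]
  simp_rw [gaussianWeight_eq_heatKernel n x₀ h]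
  rw [← integral_const_mul, ofReal_integral_eq_lintegral_ofReal]
  · refine Continuous.integrable_of_hasCompactSupport ?_ (HasCompactSupport.of_compactSpace _)
    exact continuous_const.mul ((continuous_heatKernel s x₀ t).comp hf.embedding.continuous)
  · exact Eventually.of_forall fun q => mul_nonneg (by positivity) (Real.exp_pos _).le

variable [T2Space N] {t₀ t₁ : ℝ} {F : ℝ → N → Ambient n}

/-- Huisken's monotonicity formula for the Gaussian functionals. -/
theorem gaussianF_le_gaussianF_of_isMeanCurvatureFlow (hF : IsMeanCurvatureFlow t₀ t₁ F)
    (x₀ : Ambient n) {t τ : ℝ} (ht : t ∈ Ico t₀ t₁) (hτ : 0 < τ) :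
    gaussianF n x₀ τ (areaMeasure n 1 (range (F t))) ≤
      gaussianF n x₀ (τ + (t - t₀)) (areaMeasure n 1 (range (F t₀))) := by
  let _ : MeasurableSpace N := borel N
  have : BorelSpace N := ⟨rfl⟩
  -- The kernel is made singular at time `t + τ`, so that its remaining time is `τ` at time `t` and
  -- `τ + (t - t₀)` at the start.
  have h1 : τ = (t + τ) - t := by ring
  have h2 : τ + (t - t₀) = (t + τ) - t₀ := by ring
  have hlt : t < t + τ := by linarith
  have hlt₀ : t₀ < t + τ := ht.1.trans_lt hlt
  rw [h2, gaussianF_eq_ofReal_integral_heatKernel (hF.hypersurface t₀ ⟨le_rfl, hF.lt⟩) x₀ hlt₀]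
  conv_lhs => rw [h1]
  rw [gaussianF_eq_ofReal_integral_heatKernel (hF.hypersurface t ht) x₀ hlt]
  refine ENNReal.ofReal_le_ofReal (mul_le_mul_of_nonneg_left ?_ (by positivity))
  exact antitoneOn_integral_heatKernel hF x₀ (t + τ) ⟨le_rfl, lt_min hF.lt hlt₀⟩
    ⟨ht.1, lt_min ht.2 hlt⟩ ht.1

/-- The entropy of a blow-up limit at `(y, s)` is at most the Gaussian functional of the initial
hypersurface, centred at `y` at the scale given by the elapsed time. -/
theorem entropy_le_gaussianF_of_isBlowUpLimit (hF : IsMeanCurvatureFlow t₀ t₁ F)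
    {y : Ambient n} {s : ℝ} {m : ℕ} {A : Set (Ambient n)} [IsFiniteMeasure (areaMeasure n m A)]
    (h : IsBlowUpLimit t₀ t₁ (fun t => range (F t)) y s m A) :
    entropy n (areaMeasure n m A) ≤ gaussianF n y (s - t₀) (areaMeasure n 1 (range (F t₀))) := by
  obtain ⟨hs₀, hs₁, α, hα, hαlim, hconv⟩ := h
  -- At time `-1` the limit is `mΣ` itself, with no dilation factor.
  have hrad := hconv (-1) (by norm_num)
  rw [neg_neg, Real.sqrt_one, one_smul] at hrad
  have := isFiniteMeasure_areaMeasure_range (hF.hypersurface t₀ ⟨le_rfl, hF.lt⟩) 1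
  have hinv : Tendsto (fun i => (α i)⁻¹) atTop (𝓝 0) := tendsto_inv_atTop_zero.comp hαlim
  have hinv2 : Tendsto (fun i => α i ^ (-2 : ℤ)) atTop (𝓝 0) := by
    simpa [zpow_neg, ← inv_pow] using hinv.pow 2
  refine iSup_le fun x₀ => iSup₂_le fun τ hτ => ?_
  have hτ : 0 < τ := hτ
  rw [gaussianF_eq_lintegral n x₀ hτ]
  -- The centre and scale obtained after undoing the rescaling and flowing back to `t₀`. They
  -- converge to `y` and `s - t₀`, losing all dependence on `x₀` and `τ`, so one bound serves the
  -- whole supremum.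
  refine lintegral_le_of_convergesAsRadon hrad (continuous_gaussianWeight n x₀ τ)
    (gaussianWeight_nonneg n x₀ hτ) ?_ (tendsto_gaussianF _ (sub_pos.2 hs₀)
      (x := fun i => y + (α i)⁻¹ • x₀)
      (t := fun i => τ / α i ^ 2 + (s + α i ^ (-2 : ℤ) * (-1) - t₀)) ?_ ?_)
  · have hgt : ∀ᶠ i in atTop, t₀ < s + α i ^ (-2 : ℤ) * (-1) := by
      have h1 : Tendsto (fun i => s + α i ^ (-2 : ℤ) * (-1)) atTop (𝓝 s) := by
        simpa using (hinv2.mul_const (-1)).const_add s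
      exact h1.eventually_const_lt hs₀
    filter_upwards [hgt] with i hi
    have hαi := hα i
    -- The sampled time is strictly before `s`, so it lies in the half-open interval of existence
    -- even when `s = t₁`.
    have hlt : s + α i ^ (-2 : ℤ) * (-1) < t₁ := by
      have : 0 < α i ^ (-2 : ℤ) := by positivity
      linarith
    rw [← gaussianF_eq_lintegral n x₀ hτ, parabolicRescaling,
      gaussianF_image_smul_sub x₀ y hτ hαi]
    exact gaussianF_le_gaussianF_of_isMeanCurvatureFlow hF _ ⟨hi.le, hlt⟩ (by positivity)
  · simpa using (hinv.smul_const x₀).const_add y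
  · have h1 : Tendsto (fun i => τ / α i ^ 2) atTop (𝓝 0) := by
      simpa [div_eq_mul_inv, ← inv_pow] using (hinv.pow 2).const_mul τ
    simpa using h1.add (((hinv2.mul_const (-1)).const_add s).sub_const t₀)

theorem not_isBlowUpLimit_of_localEntropy_lt (hF : IsMeanCurvatureFlow t₀ t₁ F) {y : Ambient n}
    {s : ℝ} {m : ℕ} {A : Set (Ambient n)} [IsFiniteMeasure (areaMeasure n m A)] {I : Set ℝ}
    (hs : s - t₀ ∈ I)
    (hlt : localEntropy n I (areaMeasure n 1 (range (F t₀))) < entropy n (areaMeasure n m A)) :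
    ¬ IsBlowUpLimit t₀ t₁ (fun t => range (F t)) y s m A := fun h =>
  hlt.not_ge <| (entropy_le_gaussianF_of_isBlowUpLimit hF h).trans <|
    le_iSup_of_le y <| le_iSup₂_of_le (s - t₀) hs le_rfl

end Flow

end MCF

end

theorem mainTheorem4 {n : ℕ} (hn : 1 ≤ n)
    -- `Σ`, a closed embedded self-shrinker in `ℝ^{n+1}`, and the multiplicity `m`
    {S : Type*} [TopologicalSpace S] [T2Space S] [CompactSpace S]
    [ChartedSpace (EuclideanSpace ℝ (Fin n)) S] [IsManifold (𝓡 n) ∞ S]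
    (σ : S → MCF.Ambient n) (hσ : MCF.IsSelfShrinker σ) (m : ℕ) (hm : 1 ≤ m)
    -- a mean curvature flow of closed embedded hypersurfaces starting from `M` at time `T - α⁻²`
    {N : Type*} [TopologicalSpace N] [T2Space N] [CompactSpace N]
    [ChartedSpace (EuclideanSpace ℝ (Fin n)) N] [IsManifold (𝓡 n) ∞ N]
    (M : Set (MCF.Ambient n)) (α : ℝ) (hα : 0 < α) (T T' : ℝ) (F : ℝ → N → MCF.Ambient n)
    (hF : MCF.IsMeanCurvatureFlow (T - α ^ (-2 : ℤ)) T' F)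
    (hM : Set.range (F (T - α ^ (-2 : ℤ))) = M)
    (a : ℝ) (ha : 0 < a) (ha1 : a < 1) :
    -- the finite interval
    (∀ b : ℝ, 1 < b →
      MCF.localEntropy n (Set.Icc (a * α ^ (-2 : ℤ)) (b * α ^ (-2 : ℤ))) (MCF.areaMeasure n 1 M) <
        MCF.entropy n (MCF.areaMeasure n m (Set.range σ)) →
      ∀ s ∈ Set.Icc (T + (a - 1) * α ^ (-2 : ℤ)) (T + (b - 1) * α ^ (-2 : ℤ)),
        ∀ y : MCF.Ambient n,
          ¬ MCF.IsBlowUpLimit (T - α ^ (-2 : ℤ)) T' (fun t => Set.range (F t)) y s m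
            (Set.range σ)) ∧
    -- the infinite interval
    (MCF.localEntropy n (Set.Ici (a * α ^ (-2 : ℤ))) (MCF.areaMeasure n 1 M) <
        MCF.entropy n (MCF.areaMeasure n m (Set.range σ)) →
      ∀ s ∈ Set.Ici (T + (a - 1) * α ^ (-2 : ℤ)),
        ∀ y : MCF.Ambient n,
          ¬ MCF.IsBlowUpLimit (T - α ^ (-2 : ℤ)) T' (fun t => Set.range (F t)) y s m
            (Set.range σ)) := by
  have := MCF.isFiniteMeasure_areaMeasure_range hσ.hypersurface m
  subst hM
  refine ⟨fun b _ hlt s hs y => ?_, fun hlt s hs y => ?_⟩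
  -- The relevant scale is the elapsed time `s - T + α⁻²`; adding `α⁻²` to the bounds on `s - T`
  -- turns the coefficients `a - 1` and `b - 1` into `a` and `b`.
  · refine MCF.not_isBlowUpLimit_of_localEntropy_lt hF (Set.mem_Icc.2 ?_) hlt
    constructor <;> linarith [hs.1, hs.2]
  · refine MCF.not_isBlowUpLimit_of_localEntropy_lt hF (Set.mem_Ici.2 ?_) hlt
    rw [Set.mem_Ici] at hs
    linarith
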